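/- Let $\alpha:\mathbb R\to\mathbb R$ satisfy (C1) $\alpha\in W^{2,1}(\mathbb R)$, i.e. $\alpha$ and its weak derivatives $\alpha',\alpha''$ are in $L^1(\mathbb R)$; and (C2) the distributional derivative $\alpha'''=\mu$ of $\alpha''$ is a finite (signed) Borel measure on $\mathbb R$. Let $\kappa>0$, $s>1/2$, and let $f:\mathbb R\to\mathbb R$ be of class $C^{[s]+1}$ with $f(0)=0$, where $[s]$ is the largest integer $\le s$. Let $H^s=H^s(\mathbb R)$ be the Sobolev space of real-valued functions with $\|v\|_{H^s}^2=\int_{\mathbb R}(1+\xi^2)^s|\hat v(\xi)|^2\,d\xi$ ($\hat v$ the unitary Fourier transform), and consider the Cauchy problem $$u_t+\alpha'*f(u)+\kappa\,\mu*u=0,\qquad u(x,0)=\varphi(x),\qquad (\mu*u)(x)=\int_{\mathbb R}u(x-y)\,d\mu(y).\tag{2.1--2.2}$$ (i) The problem is locally well-posed in $H^s$: for every $\varphi\in H^s$ there are $T>0$ and a ball $B\subset H^s$ around $\varphi$ such that for each $\psi\in B$ there is a solution $u_\psi\in C^1([0,T],H^s)$ with initial value $\psi$; for each $0<T'\le T$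 it is the only solution in $C^1([0,T'],H^s)$ on $[0,T']$ with this initial value; and $\psi\mapsto u_\psi$ is continuous from $B$ to $C^1([0,T],H^s)$. (ii) There is a positive nondecreasing function $C:[0,\infty)\to\mathbb R$, depending only on $\alpha$, $\kappa$, $f$ and $s$, such that for every $\varphi\in H^s$, every $T>0$ and every solution $u\in C^1([0,T],H^s)$ with initial value $\varphi$, the number $M=\sup_{0\le t\le T}\|u(t)\|_{L^\infty}$ is finite and $$\|u(t)\|_{H^s}\le\|\varphi\|_{H^s}\,e^{C(M)t},\qquad 0\le t\le T.$$ -/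

import Mathlib

open MeasureTheory Set
open scoped ENNReal NNReal FourierTransform Convolution

namespace NonlocalKdV

noncomputable section

/-! ### The real Sobolev space `H^s(ℝ)` -/

/-- The complexification of a real `L²` function. -/
def complexify : Lp ℝ 2 (volume : Measure ℝ) →L[ℝ] Lp ℂ 2 (volume : Measure ℝ) :=
  Complex.ofRealCLM.compLpL 2 volume

/-- The `L²` Fourier transform (Plancherel) of a real `L²` function, with Mathlib's convention
`∫ exp (-2πixξ) u(x) dx`. -/
def fourierL2 (u : Lp ℝ 2 (volume : Measure ℝ)) : Lp ℂ 2 (volume : Measure ℝ) :=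
  𝓕 (complexify u)

lemma fourierL2_add (u v : Lp ℝ 2 (volume : Measure ℝ)) :
    fourierL2 (u + v) = fourierL2 u + fourierL2 v := by
  simp only [fourierL2, map_add]
  exact (Lp.fourierTransformₗᵢ ℝ ℂ).map_add _ _

lemma fourierL2_smul (c : ℝ) (u : Lp ℝ 2 (volume : Measure ℝ)) :
    fourierL2 (c • u) = c • fourierL2 u := by
  have h : ∀ w : Lp ℂ 2 (volume : Measure ℝ), c • w = (c : ℂ) • w := by
    intro w
    exact (Complex.coe_smul c w).symm
  simp only [fourierL2, map_smul]
  rw [h, h]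
  exact (Lp.fourierTransformₗᵢ ℝ ℂ).map_smul _ _

lemma fourierL2_injective : Function.Injective fourierL2 := by
  intro u v h
  have h1 : complexify u = complexify v := (Lp.fourierTransformₗᵢ ℝ ℂ).injective h
  have h2 := Complex.ofRealCLM.coeFn_compLp' (p := 2) (μ := volume) u
  have h3 := Complex.ofRealCLM.coeFn_compLp' (p := 2) (μ := volume) v
  change Complex.ofRealCLM.compLp u = Complex.ofRealCLM.compLp v at h1
  rw [h1] at h2
  apply Lp.ext
  filter_upwards [h2, h3] with x hx hy
  have := hx.symm.trans hy
  simpa using this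

/-- The weight `(1 + |2πξ|²)^{s/2}`: the symbol of `(1 - ∂ₓ²)^{s/2}`. -/
def weight (s ξ : ℝ) : ℝ := (1 + (2 * Real.pi * ξ) ^ 2) ^ (s / 2)

lemma weight_pos (s ξ : ℝ) : 0 < weight s ξ := by
  unfold weight; positivity

/-- `ξ ↦ (1 + |2πξ|²)^{s/2} û(ξ)`. -/
def weightedFourier (s : ℝ) (u : Lp ℝ 2 (volume : Measure ℝ)) : ℝ → ℂ :=
  fun ξ => (weight s ξ : ℂ) * fourierL2 u ξ

lemma weightedFourier_add (s : ℝ) (u v : Lp ℝ 2 (volume : Measure ℝ)) :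
    weightedFourier s (u + v) =ᵐ[volume] weightedFourier s u + weightedFourier s v := by
  have h := Lp.coeFn_add (fourierL2 u) (fourierL2 v)
  rw [← fourierL2_add] at h
  filter_upwards [h] with ξ hξ
  simp only [weightedFourier, Pi.add_apply, hξ, mul_add]

lemma weightedFourier_smul (s c : ℝ) (u : Lp ℝ 2 (volume : Measure ℝ)) :
    weightedFourier s (c • u) =ᵐ[volume] c • weightedFourier s u := by
  have h := Lp.coeFn_smul c (fourierL2 u)
  rw [← fourierL2_smul] at h
  filter_upwards [h] with ξ hξ
  simp only [weightedFourier, Pi.smul_apply, hξ, Complex.real_smul]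
  ring

/-- Membership in `H^s(ℝ)`, for real-valued functions in `L²(ℝ)` and `s ≥ 0`:
`(1 + |2πξ|²)^{s/2} û ∈ L²`. -/
def sobolevSubmodule (s : ℝ) : Submodule ℝ (Lp ℝ 2 (volume : Measure ℝ)) where
  carrier := {u | MemLp (weightedFourier s u) 2 volume}
  add_mem' {u v} hu hv := (memLp_congr_ae (weightedFourier_add s u v)).2 (hu.add hv)
  zero_mem' := by
    have h := weightedFourier_smul s 0 0
    rw [zero_smul, zero_smul] at h
    exact (memLp_congr_ae h).2 MemLp.zero
  smul_mem' c u hu := (memLp_congr_ae (weightedFourier_smul s c u)).2 (hu.const_smul c)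

/-- The `L²`-based Sobolev space `H^s(ℝ)` (`s ≥ 0`) of real-valued functions. It is a type of its
own, so that it carries the `H^s` norm below and not the `L²` norm. -/
def Hs (s : ℝ) : Type := sobolevSubmodule s

namespace Hs

instance (s : ℝ) : AddCommGroup (Hs s) := inferInstanceAs (AddCommGroup (sobolevSubmodule s))

instance (s : ℝ) : Module ℝ (Hs s) := inferInstanceAs (Module ℝ (sobolevSubmodule s))

/-- The underlying element of `L²(ℝ)`. -/
def toL2 {s : ℝ} (u : Hs s) : Lp ℝ 2 (volume : Measure ℝ) := u.1

lemma memLp_weightedFourier {s : ℝ} (u : Hs s) : MemLp (weightedFourier s (toL2 u)) 2 volume := u.2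

lemma toL2_add {s : ℝ} (u v : Hs s) : toL2 (u + v) = toL2 u + toL2 v := rfl

lemma toL2_smul {s : ℝ} (c : ℝ) (u : Hs s) : toL2 (c • u) = c • toL2 u := rfl

/-- A representative of `u ∈ H^s(ℝ)`, as a function determined up to null sets. -/
instance (s : ℝ) : CoeFun (Hs s) (fun _ => ℝ → ℝ) := ⟨fun u => (toL2 u : ℝ → ℝ)⟩

/-- The linear map `u ↦ (1 + |2πξ|²)^{s/2} û` from `H^s(ℝ)` to `L²`. -/
def toWeightedL2 (s : ℝ) : Hs s →ₗ[ℝ] Lp ℂ 2 (volume : Measure ℝ) where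
  toFun u := MemLp.toLp (weightedFourier s (toL2 u)) (memLp_weightedFourier u)
  map_add' u v :=
    (MemLp.toLp_congr _ ((memLp_weightedFourier u).add (memLp_weightedFourier v))
      (weightedFourier_add s (toL2 u) (toL2 v))).trans (MemLp.toLp_add _ _)
  map_smul' c u :=
    (MemLp.toLp_congr _ ((memLp_weightedFourier u).const_smul c)
      (weightedFourier_smul s c (toL2 u))).trans (MemLp.toLp_const_smul c _)

lemma toWeightedL2_injective (s : ℝ) : Function.Injective (toWeightedL2 s) := by
  intro u v h
  have h1 : weightedFourier s (toL2 u) =ᵐ[volume] weightedFourier s (toL2 v) :=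
    
    (MemLp.toLp_eq_toLp_iff (memLp_weightedFourier u) (memLp_weightedFourier v)).1 h
  refine Subtype.ext (fourierL2_injective (Lp.ext ?_))
  filter_upwards [h1] with ξ hξ
  have hw : (weight s ξ : ℂ) ≠ 0 := by exact_mod_cast (weight_pos s ξ).ne'
  exact mul_left_cancel₀ hw hξ

/-- The `H^s` norm `‖u‖ = ‖(1 + |2πξ|²)^{s/2} û‖_{L²}`. -/
instance (s : ℝ) : NormedAddCommGroup (Hs s) :=
  NormedAddCommGroup.induced (Hs s) (Lp ℂ 2 (volume : Measure ℝ)) (toWeightedL2 s)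
    (toWeightedL2_injective s)

instance (s : ℝ) : NormedSpace ℝ (Hs s) :=
  NormedSpace.induced ℝ (Hs s) (Lp ℂ 2 (volume : Measure ℝ)) (toWeightedL2 s)

end Hs

/-! ### Conditions on the kernel -/

/-- `g'` is the weak derivative of `g` on `ℝ`. It is used for integrable `g`, `g'`. -/
def IsWeakDeriv (g g' : ℝ → ℝ) : Prop :=
  ∀ η : ℝ → ℝ, ContDiff ℝ ((⊤ : ℕ∞) : WithTop ℕ∞) η → HasCompactSupport η →
    ∫ x, g x * deriv η x = -∫ x, g' x * η x

/-- `α ∈ W^{2,1}(ℝ)`, with first and second weak derivatives `α'` and `α''`. -/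
structure CondC1 (α α' α'' : ℝ → ℝ) : Prop where
  integrable : Integrable α
  integrable_deriv : Integrable α'
  integrable_deriv2 : Integrable α''
  weakDeriv : IsWeakDeriv α α'
  weakDeriv2 : IsWeakDeriv α' α''

/-- The distributional derivative of `α''` is the finite (signed) Borel measure `μ`.
Every `SignedMeasure ℝ` is finite. -/
def CondC2 (α'' : ℝ → ℝ) (μ : SignedMeasure ℝ) : Prop :=
  ∀ η : ℝ → ℝ, ContDiff ℝ ((⊤ : ℕ∞) : WithTop ℕ∞) η → HasCompactSupport η →
    ∫ x, α'' x * deriv η x = -∫ᵛ x, η x ∂•μ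

/-! ### The Cauchy problem -/

/-- `u ∈ C¹([0,T], H^s(ℝ))` solves `u_t + α' ∗ f(u) + κ μ ∗ u = 0` (`μ = α'''`) on `[0,T]` with
`u(0) = φ`. The time derivative is taken in `H^s(ℝ)` (one-sided at the end points), and the equation
is an identity between functions of `x` up to null sets. -/
structure IsSolution (α' : ℝ → ℝ) (μ : SignedMeasure ℝ) (κ : ℝ) (f : ℝ → ℝ) {s : ℝ} (T : ℝ)
    (φ : Hs s) (u : ℝ → Hs s) : Prop where
  contDiffOn : ContDiffOn ℝ 1 u (Icc 0 T)
  initial : u 0 = φ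
  equation : ∀ t ∈ Icc 0 T, ∀ᵐ x : ℝ,
    derivWithin u (Icc 0 T) t x
      + (α' ⋆[ContinuousLinearMap.mul ℝ ℝ, volume] fun y => f (u t y)) x
      + κ * ∫ᵛ y, u t (x - y) ∂•μ = 0

/-- Local well-posedness (in the sense of Hadamard) at `φ ∈ H^s(ℝ)`: for some `T > 0` and all data
`ψ` in a ball around `φ` there is a solution `S ψ ∈ C¹([0,T], H^s)`; it is the only solution in this
class, also on shorter time intervals; and `ψ ↦ S ψ` is continuous into `C¹([0,T], H^s)`. -/
def LocallyWellPosedAt (α' : ℝ → ℝ) (μ : SignedMeasure ℝ) (κ : ℝ) (f : ℝ → ℝ) {s : ℝ}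
    (φ : Hs s) : Prop :=
  ∃ T > 0, ∃ r > 0, ∃ S : Hs s → ℝ → Hs s,
    (∀ ψ ∈ Metric.ball φ r, IsSolution α' μ κ f T ψ (S ψ)) ∧
    (∀ ψ ∈ Metric.ball φ r, ∀ T' ∈ Ioc 0 T, ∀ v : ℝ → Hs s,
      IsSolution α' μ κ f T' ψ v → EqOn v (S ψ) (Icc 0 T')) ∧
    (∀ ψ ∈ Metric.ball φ r, ∀ ε > 0, ∃ δ > 0, ∀ χ ∈ Metric.ball φ r, ‖χ - ψ‖ < δ →
      ∀ t ∈ Icc 0 T, ‖S χ t - S ψ t‖ < ε ∧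
        ‖derivWithin (S χ) (Icc 0 T) t - derivWithin (S ψ) (Icc 0 T) t‖ < ε)

/-- `sup_{0 ≤ t ≤ T} ‖u(t)‖_{L^∞}`, as an extended real number. -/
def supLinfty {s : ℝ} (T : ℝ) (u : ℝ → Hs s) : ℝ≥0∞ :=
  ⨆ t ∈ Icc 0 T, eLpNorm (u t) ∞ volume

end

end NonlocalKdV

namespace NonlocalKdV

noncomputable section

/-! ### The Fourier transform on `L²` -/

lemma integral_mul_fourier (h : Lp ℂ 2 (volume : Measure ℝ)) (φ : SchwartzMap ℝ ℂ) :
    ∫ ξ, φ ξ * (𝓕 h : Lp ℂ 2 (volume : Measure ℝ)) ξ = ∫ x, 𝓕 φ x * h x := by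
  have := congrArg (fun T => T φ) (Lp.fourier_toTemperedDistribution_eq h)
  simpa [Lp.toTemperedDistribution_apply] using this.symm

lemma integral_mul_fourierInv (h : Lp ℂ 2 (volume : Measure ℝ)) (φ : SchwartzMap ℝ ℂ) :
    ∫ ξ, φ ξ * (𝓕⁻ h : Lp ℂ 2 (volume : Measure ℝ)) ξ = ∫ x, 𝓕⁻ φ x * h x := by
  have := congrArg (fun T => T φ) (Lp.fourierInv_toTemperedDistribution_eq h)
  simpa [Lp.toTemperedDistribution_apply] using this.symm

lemma ae_eq_of_integral_schwartz {a b : ℝ → ℂ} (ha : LocallyIntegrable a) (hb : LocallyIntegrable b)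
    (h : ∀ φ : SchwartzMap ℝ ℂ, HasCompactSupport φ → ∫ x, φ x * a x = ∫ x, φ x * b x) :
    a =ᵐ[volume] b := by
  refine ae_eq_of_integral_contDiff_smul_eq ha hb fun g hg hgc => ?_
  have hc : HasCompactSupport (fun x => (g x : ℂ)) :=
    hgc.comp_left (g := fun y : ℝ => (y : ℂ)) (by simp)
  have hs : ContDiff ℝ ((⊤ : ℕ∞) : WithTop ℕ∞) (fun x => (g x : ℂ)) :=
    Complex.ofRealCLM.contDiff.comp hg
  have := h (hc.toSchwartzMap hs) hc
  simpa using this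

lemma memLp_two_locallyIntegrable {a : ℝ → ℂ} (ha : MemLp a 2 volume) : LocallyIntegrable a :=
  ha.locallyIntegrable (by norm_num)

lemma fourier_ae_eq_of_test (h : Lp ℂ 2 (volume : Measure ℝ)) {g : ℝ → ℂ}
    (hg : LocallyIntegrable g)
    (H : ∀ φ : SchwartzMap ℝ ℂ, HasCompactSupport φ → ∫ x, φ x * g x = ∫ x, 𝓕 φ x * h x) :
    (𝓕 h : Lp ℂ 2 (volume : Measure ℝ)) =ᵐ[volume] g := by
  refine ae_eq_of_integral_schwartz (memLp_two_locallyIntegrable (Lp.memLp _)) hg fun φ hφ => ?_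
  rw [integral_mul_fourier, H φ hφ]

lemma locallyIntegrable_fourier {g : ℝ → ℂ} (hg : Integrable g) : LocallyIntegrable (𝓕 g) :=
  (VectorFourier.fourierIntegral_continuous Real.continuous_fourierChar
    (by exact continuous_inner) hg).locallyIntegrable

lemma fourier_toLp_ae_eq {g : ℝ → ℂ} (hg : Integrable g) (hg2 : MemLp g 2 volume) :
    (𝓕 (hg2.toLp g) : Lp ℂ 2 (volume : Measure ℝ)) =ᵐ[volume] 𝓕 g := by
  refine fourier_ae_eq_of_test _ (locallyIntegrable_fourier hg) fun φ _ => ?_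
  have h1 : ∫ x, 𝓕 φ x * (hg2.toLp g : ℝ → ℂ) x = ∫ x, 𝓕 φ x * g x := by
    refine integral_congr_ae ?_
    filter_upwards [hg2.coeFn_toLp] with x hx
    rw [hx]
  rw [h1]
  have := VectorFourier.integral_fourierIntegral_smul_eq_flip (L := innerₗ ℝ) (μ := volume)
    (ν := volume) Real.continuous_fourierChar continuous_inner φ.integrable hg
  simp only [smul_eq_mul, flip_innerₗ] at this
  exact this.symm

lemma fourierInv_toLp_ae_eq {g : ℝ → ℂ} (hg : Integrable g) (hg2 : MemLp g 2 volume) :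
    (𝓕⁻ (hg2.toLp g) : Lp ℂ 2 (volume : Measure ℝ)) =ᵐ[volume] 𝓕⁻ g := by
  have e : ∀ k : ℝ → ℂ, 𝓕⁻ k = 𝓕 (fun x => k (-x)) := fun k => Real.fourierInv_eq_fourier_comp_neg k
  have hgn : Integrable (fun x => g (-x)) := hg.comp_neg
  refine ae_eq_of_integral_schwartz (memLp_two_locallyIntegrable (Lp.memLp _))
    (e g ▸ locallyIntegrable_fourier hgn) fun φ _ => ?_
  rw [integral_mul_fourierInv]
  have h1 : ∫ x, 𝓕⁻ φ x * (hg2.toLp g : ℝ → ℂ) x = ∫ x, 𝓕⁻ φ x * g x := by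
    refine integral_congr_ae ?_
    filter_upwards [hg2.coeFn_toLp] with x hx
    rw [hx]
  rw [h1, e g]
  have := VectorFourier.integral_fourierIntegral_smul_eq_flip (L := innerₗ ℝ) (μ := volume)
    (ν := volume) Real.continuous_fourierChar continuous_inner φ.integrable hgn
  simp only [smul_eq_mul, flip_innerₗ] at this
  refine Eq.trans ?_ this
  rw [← integral_neg_eq_self]
  refine integral_congr_ae (Filter.Eventually.of_forall fun x => ?_)
  simp only [SchwartzMap.fourierInv_coe, Real.fourierInv_eq_fourier_neg, neg_neg]
  rfl

lemma eLpNorm_fourier {g : ℝ → ℂ} (hg : Integrable g) (hg2 : MemLp g 2 volume) :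
    eLpNorm (𝓕 g) 2 volume = eLpNorm g 2 volume := by
  rw [← eLpNorm_congr_ae (fourier_toLp_ae_eq hg hg2)]
  have := Lp.norm_fourier_eq (hg2.toLp g)
  rw [Lp.norm_def, Lp.norm_def, ENNReal.toReal_eq_toReal_iff' (Lp.eLpNorm_ne_top _)
    (Lp.eLpNorm_ne_top _)] at this
  rw [this, eLpNorm_congr_ae hg2.coeFn_toLp]

lemma complexify_ae (u : Lp ℝ 2 (volume : Measure ℝ)) :
    complexify u =ᵐ[volume] fun x => (u x : ℂ) := by
  filter_upwards [Complex.ofRealCLM.coeFn_compLp' (p := 2) (μ := volume) u] with x hx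
  exact hx

lemma eLpNorm_fourierL2 (u : Lp ℝ 2 (volume : Measure ℝ)) :
    eLpNorm (fourierL2 u) 2 volume = eLpNorm u 2 volume := by
  have h1 := Lp.norm_fourier_eq (complexify u)
  rw [Lp.norm_def, Lp.norm_def, ENNReal.toReal_eq_toReal_iff' (Lp.eLpNorm_ne_top _)
    (Lp.eLpNorm_ne_top _), eLpNorm_congr_ae (complexify_ae u)] at h1
  rw [fourierL2, h1]
  exact eLpNorm_congr_norm_ae (Filter.Eventually.of_forall fun x => by simp)

/-- Characterisation of the `L²` Fourier transform of a real function by test functions. -/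
lemma fourierL2_ae_eq_of_test (u : Lp ℝ 2 (volume : Measure ℝ)) {g : ℝ → ℂ}
    (hg : LocallyIntegrable g)
    (H : ∀ φ : SchwartzMap ℝ ℂ, HasCompactSupport φ → ∫ x, φ x * g x = ∫ x, 𝓕 φ x * (u x : ℂ)) :
    fourierL2 u =ᵐ[volume] g := by
  refine fourier_ae_eq_of_test _ hg fun φ hφ => (H φ hφ).trans (integral_congr_ae ?_)
  filter_upwards [complexify_ae u] with x hx
  rw [hx]

lemma integral_mul_fourierL2 (u : Lp ℝ 2 (volume : Measure ℝ)) (φ : SchwartzMap ℝ ℂ) :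
    ∫ ξ, φ ξ * fourierL2 u ξ = ∫ x, 𝓕 φ x * (u x : ℂ) := by
  rw [fourierL2, integral_mul_fourier]
  refine integral_congr_ae ?_
  filter_upwards [complexify_ae u] with x hx
  rw [hx]

/-- The Fourier transform of a classical derivative. -/
lemma fourierL2_deriv {w w' : ℝ → ℝ} (hd : ∀ x, HasDerivAt w (w' x) x)
    {u u' : Lp ℝ 2 (volume : Measure ℝ)} (hu : u =ᵐ[volume] w) (hu' : u' =ᵐ[volume] w') :
    fourierL2 u' =ᵐ[volume] fun ξ => (2 * Real.pi * Complex.I * ξ) * fourierL2 u ξ := by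
  have hw : MemLp (fun x => (w x : ℂ)) 2 volume :=
    (memLp_congr_ae hu).1 (Lp.memLp u) |>.ofReal
  have hw' : MemLp (fun x => (w' x : ℂ)) 2 volume :=
    (memLp_congr_ae hu').1 (Lp.memLp u') |>.ofReal
  have hg : LocallyIntegrable (fun ξ : ℝ => (2 * Real.pi * Complex.I * ξ) * fourierL2 u ξ) :=
    (memLp_two_locallyIntegrable (Lp.memLp _)).continuous_mul (by fun_prop)
  refine fourierL2_ae_eq_of_test _ hg fun φ _ => ?_
  have ht : (fun ξ : ℝ => (2 * Real.pi * Complex.I * ξ : ℂ)).HasTemperateGrowth := by fun_prop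
  set ψ : SchwartzMap ℝ ℂ := SchwartzMap.smulLeftCLM ℂ (fun ξ : ℝ => (2 * Real.pi * Complex.I * ξ : ℂ)) φ
    with hψ
  have hψa : ∀ ξ, ψ ξ = (2 * Real.pi * Complex.I * ξ) * φ ξ := fun ξ => by
    rw [hψ, SchwartzMap.smulLeftCLM_apply_apply ht, smul_eq_mul]
  have hF : ∀ x, HasDerivAt (𝓕 φ : SchwartzMap ℝ ℂ) (-(𝓕 ψ x)) x := by
    intro x
    have h2 : Integrable (fun x : ℝ => x • φ x) := by
      have := φ.integrable_pow_mul volume 1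
      refine this.mono' (by fun_prop) (Filter.Eventually.of_forall fun x => ?_)
      simp
    have := Real.hasDerivAt_fourier φ.integrable h2 x
    have e : 𝓕 (fun x : ℝ => (-2 * Real.pi * Complex.I * x : ℂ) • φ x) x = -(𝓕 ψ x) := by
      rw [SchwartzMap.fourier_coe, Real.fourier_eq, Real.fourier_eq, ← integral_neg]
      refine integral_congr_ae (Filter.Eventually.of_forall fun y => ?_)
      simp only [hψa, smul_eq_mul, Circle.smul_def]
      ring
    rw [e] at this
    exact this
  have h1 : ∫ x, φ x * (2 * Real.pi * Complex.I * x * fourierL2 u x) = ∫ x, ψ x * fourierL2 u x := by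
    refine integral_congr_ae (Filter.Eventually.of_forall fun y => ?_)
    simp only [hψa]; ring
  rw [h1, integral_mul_fourierL2]
  have e1 : ∫ x, 𝓕 ψ x * (u x : ℂ) = ∫ x, 𝓕 ψ x * (w x : ℂ) := by
    refine integral_congr_ae ?_
    filter_upwards [hu] with x hx
    rw [hx]
  have e2 : ∫ x, 𝓕 φ x * (u' x : ℂ) = ∫ x, 𝓕 φ x * (w' x : ℂ) := by
    refine integral_congr_ae ?_
    filter_upwards [hu'] with x hx
    rw [hx]
  rw [e1, e2]
  have m1 : MemLp (𝓕 φ : SchwartzMap ℝ ℂ) 2 volume := SchwartzMap.memLp _ _ _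
  have m2 : MemLp (fun x => -(𝓕 ψ : SchwartzMap ℝ ℂ) x) 2 volume := (SchwartzMap.memLp _ _ _).neg
  have := integral_mul_deriv_eq_deriv_mul_of_integrable (fun x _ => hF x)
    (fun x _ => (hd x).ofReal_comp) (m1.integrable_mul hw') (m2.integrable_mul hw)
    (m1.integrable_mul hw)
  rw [this, ← integral_neg]
  simp

lemma fourierL2_iteratedDeriv {n : ℕ} {w : ℝ → ℝ} (hw : ContDiff ℝ n w)
    (hL : ∀ j ≤ n, MemLp (iteratedDeriv j w) 2 volume)
    {u : Lp ℝ 2 (volume : Measure ℝ)} (hu : u =ᵐ[volume] w) {j : ℕ} (hj : j ≤ n) :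
    fourierL2 ((hL j hj).toLp _) =ᵐ[volume]
      fun ξ => (2 * Real.pi * Complex.I * ξ) ^ j * fourierL2 u ξ := by
  induction j with
  | zero =>
    have : (hL 0 hj).toLp _ = u := by
      refine Lp.ext ((hL 0 hj).coeFn_toLp.trans ?_)
      simpa using hu.symm
    rw [this]
    simp
  | succ j ih =>
    have hj' : j < n := hj
    have hd : ∀ x, HasDerivAt (iteratedDeriv j w) (iteratedDeriv (j + 1) w x) x := by
      intro x
      rw [iteratedDeriv_succ]
      exact (hw.differentiable_iteratedDeriv j (by exact_mod_cast hj') x).hasDerivAt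
    filter_upwards [fourierL2_deriv hd (hL j hj'.le).coeFn_toLp (hL (j + 1) hj).coeFn_toLp,
      ih hj'.le] with ξ h1 h2
    rw [h1, h2]
    ring

lemma weight_nat_le (n : ℕ) (ξ : ℝ) : weight n ξ ≤ 2 ^ n * (1 + |2 * Real.pi * ξ| ^ n) := by
  set t := |2 * Real.pi * ξ| with ht
  have h0 : 0 ≤ t := abs_nonneg _
  have h1 : weight n ξ ≤ ((1 + t) ^ 2) ^ ((n : ℝ) / 2) := by
    unfold weight
    refine Real.rpow_le_rpow (by positivity) ?_ (by positivity)
    rw [← sq_abs (2 * Real.pi * ξ), ← ht]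
    nlinarith
  have h2 : ((1 + t) ^ 2) ^ ((n : ℝ) / 2) = (1 + t) ^ n := by
    rw [← Real.rpow_natCast, ← Real.rpow_mul (by positivity), ← Real.rpow_natCast]
    congr 1; push_cast; ring
  rw [h2] at h1
  refine h1.trans ((add_pow_le zero_le_one h0 n).trans ?_)
  rw [one_pow]
  gcongr
  · norm_num
  · omega

lemma eLpNorm_weightedFourier_le {n : ℕ} {w : ℝ → ℝ} (hw : ContDiff ℝ n w)
    (hL : ∀ j ≤ n, MemLp (iteratedDeriv j w) 2 volume)
    {u : Lp ℝ 2 (volume : Measure ℝ)} (hu : u =ᵐ[volume] w) :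
    eLpNorm (weightedFourier n u) 2 volume ≤
      2 ^ n * (eLpNorm w 2 volume + eLpNorm (iteratedDeriv n w) 2 volume) := by
  have h1 := fourierL2_iteratedDeriv hw hL hu le_rfl
  set v : Lp ℝ 2 (volume : Measure ℝ) := (hL n le_rfl).toLp _ with hv
  have e1 : eLpNorm w 2 volume = eLpNorm (fun ξ => ‖fourierL2 u ξ‖) 2 volume := by
    rw [eLpNorm_norm, eLpNorm_fourierL2, eLpNorm_congr_ae hu]
  have e2 : eLpNorm (iteratedDeriv n w) 2 volume = eLpNorm (fun ξ => ‖fourierL2 v ξ‖) 2 volume := by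
    rw [eLpNorm_norm, eLpNorm_fourierL2, hv, eLpNorm_congr_ae (hL n le_rfl).coeFn_toLp]
  have h2 : ∀ᵐ ξ, ‖weightedFourier n u ξ‖ ≤ 2 ^ n * ‖(‖fourierL2 u ξ‖ + ‖fourierL2 v ξ‖)‖ := by
    filter_upwards [h1] with ξ hξ
    rw [hξ, weightedFourier, norm_mul, norm_mul, norm_pow, Complex.norm_real,
      Real.norm_of_nonneg (weight_pos _ _).le, Real.norm_of_nonneg (by positivity)]
    have : ‖(2 * Real.pi * Complex.I * ξ : ℂ)‖ = |2 * Real.pi * ξ| := by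
      simp [abs_mul]
    rw [this]
    calc _ ≤ 2 ^ n * (1 + |2 * Real.pi * ξ| ^ n) * ‖fourierL2 u ξ‖ := by
            gcongr; exact weight_nat_le n ξ
      _ = _ := by ring
  refine (eLpNorm_le_mul_eLpNorm_of_ae_le_mul h2 2).trans ?_
  rw [e1, e2, ENNReal.ofReal_pow (by norm_num), ENNReal.ofReal_ofNat]
  gcongr
  exact eLpNorm_add_le (Lp.aestronglyMeasurable _).norm (Lp.aestronglyMeasurable _).norm
    (by norm_num)

lemma aestronglyMeasurable_weightedFourier (s : ℝ) (u : Lp ℝ 2 (volume : Measure ℝ)) :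
    AEStronglyMeasurable (weightedFourier s u) volume := by
  refine AEStronglyMeasurable.mul ?_ (Lp.aestronglyMeasurable _)
  refine Continuous.aestronglyMeasurable ?_
  refine Complex.continuous_ofReal.comp ?_
  unfold weight
  exact Continuous.rpow_const (by fun_prop) fun x => Or.inl (by positivity)

lemma Hs.norm_def {s : ℝ} (u : Hs s) :
    ‖u‖ = (eLpNorm (weightedFourier s (Hs.toL2 u)) 2 volume).toReal := by
  change ‖Hs.toWeightedL2 s u‖ = _
  exact Lp.norm_toLp _ (Hs.memLp_weightedFourier u)

lemma Hs.eLpNorm_weightedFourier {s : ℝ} (u : Hs s) :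
    eLpNorm (weightedFourier s (Hs.toL2 u)) 2 volume = ENNReal.ofReal ‖u‖ := by
  rw [Hs.norm_def, ENNReal.ofReal_toReal (Hs.memLp_weightedFourier u).2.ne]

lemma continuous_weight (s : ℝ) : Continuous (weight s) := by
  unfold weight
  exact Continuous.rpow_const (by fun_prop) fun x => Or.inl (by positivity)

lemma weight_add (a b ξ : ℝ) : weight (a + b) ξ = weight a ξ * weight b ξ := by
  unfold weight
  rw [add_div, Real.rpow_add (by positivity)]

lemma weight_mono {a b : ℝ} (hab : a ≤ b) (ξ : ℝ) : weight a ξ ≤ weight b ξ := by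
  unfold weight
  exact Real.rpow_le_rpow_of_exponent_le (by nlinarith [sq_nonneg (2 * Real.pi * ξ)]) (by linarith)

lemma pow_le_weight (j : ℕ) (ξ : ℝ) : |2 * Real.pi * ξ| ^ j ≤ weight j ξ := by
  unfold weight
  rw [← Real.sqrt_sq_eq_abs, Real.sqrt_eq_rpow, ← Real.rpow_natCast, ← Real.rpow_mul (by positivity)]
  rw [show 1 / 2 * (j : ℝ) = j / 2 by ring]
  exact Real.rpow_le_rpow (by positivity) (by linarith) (by positivity)

lemma memLp_weight {a : ℝ} (ha : a < -(1 / 2)) : MemLp (weight a) 2 volume := by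
  rw [memLp_two_iff_integrable_sq (continuous_weight a).aestronglyMeasurable]
  have h := integrable_rpow_neg_one_add_norm_sq (E := ℝ) (μ := volume) (r := -(2 * a))
    (by simp; linarith)
  have h2 := h.comp_mul_left' (R := 2 * Real.pi) (by positivity)
  refine h2.congr (Filter.Eventually.of_forall fun ξ => ?_)
  simp only [weight, Real.norm_eq_abs, sq_abs]
  rw [← Real.rpow_mul_natCast (by positivity)]
  congr 1
  push_cast; ring

/-- The weighted Fourier transform of order `j` is integrable for `j + 1/2 < s`. -/
lemma Hs.integrable_pow_mul_fourier {s : ℝ} {j : ℕ} (hs : j + 1 / 2 < s) :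
    ∃ C : ℝ, 0 ≤ C ∧ ∀ u : Hs s,
      Integrable (fun ξ => |2 * Real.pi * ξ| ^ j * ‖fourierL2 (Hs.toL2 u) ξ‖) ∧
      ∫ ξ, |2 * Real.pi * ξ| ^ j * ‖fourierL2 (Hs.toL2 u) ξ‖ ≤ C * ‖u‖ := by
  have hw : MemLp (weight (j - s)) 2 volume := memLp_weight (by linarith)
  refine ⟨(eLpNorm (weight (j - s)) 2 volume).toReal, ENNReal.toReal_nonneg, fun u => ?_⟩
  set û := fourierL2 (Hs.toL2 u)
  have hm : MemLp (fun ξ => ‖weightedFourier s (Hs.toL2 u) ξ‖) 2 volume :=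
    (Hs.memLp_weightedFourier u).norm
  have hi := hw.integrable_mul hm
  have hle : ∀ ξ, |2 * Real.pi * ξ| ^ j * ‖û ξ‖ ≤
      weight (j - s) ξ * ‖weightedFourier s (Hs.toL2 u) ξ‖ := by
    intro ξ
    rw [weightedFourier, norm_mul, Complex.norm_real, Real.norm_of_nonneg (weight_pos _ _).le,
      ← mul_assoc, ← weight_add]
    rw [show (j : ℝ) - s + s = j by ring]
    gcongr
    exact pow_le_weight j ξ
  have hI : Integrable (fun ξ => |2 * Real.pi * ξ| ^ j * ‖û ξ‖) := by
    refine hi.mono' ?_ (Filter.Eventually.of_forall fun ξ => ?_)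
    · exact (Continuous.aestronglyMeasurable (by fun_prop)).mul (Lp.aestronglyMeasurable _).norm
    · rw [Real.norm_of_nonneg (by positivity)]
      exact hle ξ
  refine ⟨hI, (integral_mono hI hi hle).trans ?_⟩
  have h1 : ∫ ξ, weight (j - s) ξ * ‖weightedFourier s (Hs.toL2 u) ξ‖ =
      (eLpNorm (weight (j - s) • fun ξ => ‖weightedFourier s (Hs.toL2 u) ξ‖) 1 volume).toReal := by
    rw [smul_eq_mul, eLpNorm_one_eq_lintegral_enorm, ← integral_norm_eq_lintegral_enorm hi.1]
    refine integral_congr_ae (Filter.Eventually.of_forall fun ξ => ?_)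
    simp [abs_of_pos (weight_pos _ _)]
  change ∫ ξ, weight (j - s) ξ * ‖weightedFourier s (Hs.toL2 u) ξ‖ ≤ _
  rw [h1, Hs.norm_def u, ← ENNReal.toReal_mul]
  refine ENNReal.toReal_mono (ENNReal.mul_ne_top hw.2.ne (Hs.memLp_weightedFourier u).2.ne) ?_
  refine (eLpNorm_smul_le_mul_eLpNorm (p := 2) (q := 2) (r := 1) hm.1 hw.1).trans ?_
  rw [eLpNorm_norm]

lemma Hs.memLp_pow_mul_fourier {s : ℝ} {j : ℕ} (hs : j ≤ s) (u : Hs s) :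
    eLpNorm (fun ξ => |2 * Real.pi * ξ| ^ j * ‖fourierL2 (Hs.toL2 u) ξ‖) 2 volume ≤
      ENNReal.ofReal ‖u‖ := by
  rw [← Hs.eLpNorm_weightedFourier]
  refine eLpNorm_mono fun ξ => ?_
  rw [Real.norm_of_nonneg (by positivity), weightedFourier, norm_mul, Complex.norm_real,
      Real.norm_of_nonneg (weight_pos _ _).le]
  gcongr
  exact (pow_le_weight j ξ).trans (weight_mono hs ξ)

/-- The Sobolev embedding: elements of `H^s` have `C^n` representatives for `n + 1/2 < s`. -/
theorem Hs.exists_rep {s : ℝ} {n : ℕ} (hs : n + 1 / 2 < s) :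
    ∃ C : ℝ, 0 ≤ C ∧ ∀ u : Hs s, ∃ w : ℝ → ℝ, u =ᵐ[volume] w ∧ ContDiff ℝ n w ∧
      ∀ j ≤ n, (∀ x, |iteratedDeriv j w x| ≤ C * ‖u‖) ∧ MemLp (iteratedDeriv j w) 2 volume ∧
        eLpNorm (iteratedDeriv j w) 2 volume ≤ ENNReal.ofReal ‖u‖ := by
  have hj : ∀ j ≤ n, (j : ℝ) + 1 / 2 < s := fun j hj => by
    have : (j : ℝ) ≤ n := by exact_mod_cast hj
    linarith
  choose! C hC0 hC using fun j hj' => Hs.integrable_pow_mul_fourier (hj j hj')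
  refine ⟨∑ j ∈ Finset.range (n + 1), C j, Finset.sum_nonneg fun j hj' =>
    hC0 j (by simpa [Nat.lt_succ_iff] using hj'), fun u => ?_⟩
  set û : ℝ → ℂ := (fourierL2 (Hs.toL2 u) : ℝ → ℂ) with hû
  have hûm : MemLp û 2 volume := Lp.memLp _
  set g : ℝ → ℂ := fun ξ => û (-ξ) with hg
  have hmeas : ∀ j : ℕ, AEStronglyMeasurable
      (fun ξ : ℝ => (-2 * Real.pi * Complex.I * ξ : ℂ) ^ j • g ξ) volume := fun j => by
    have hc : Continuous (fun ξ : ℝ => (-2 * Real.pi * Complex.I * ξ : ℂ) ^ j) := by fun_prop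
    exact hc.aestronglyMeasurable.smul
      (hûm.1.comp_measurePreserving (Measure.measurePreserving_neg volume))
  have hint : ∀ j ≤ n, Integrable (fun ξ : ℝ => (-2 * Real.pi * Complex.I * ξ : ℂ) ^ j • g ξ) := by
    intro j hj'
    have := (hC j hj' u).1.comp_neg
    refine this.mono' ?_ (Filter.Eventually.of_forall fun ξ => ?_)
    · exact hmeas j
    · simp [hg, hû, abs_mul]
  have hint' : ∀ j : ℕ, (j : ℕ∞) ≤ (n : ℕ∞) → Integrable (fun ξ : ℝ => ξ ^ j • g ξ) := by
    intro j hj'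
    have := (hint j (by exact_mod_cast hj')).const_mul ((-2 * Real.pi * Complex.I : ℂ) ^ j)⁻¹
    refine this.congr (Filter.Eventually.of_forall fun ξ => ?_)
    have h0 : (-2 * Real.pi * Complex.I : ℂ) ≠ 0 := by simp [Real.pi_ne_zero]
    simp only [smul_eq_mul, mul_pow, Complex.real_smul, Complex.ofReal_pow]
    field_simp
  have hL : ∀ j ≤ n, eLpNorm (fun ξ : ℝ => (-2 * Real.pi * Complex.I * ξ : ℂ) ^ j • g ξ) 2 volume ≤
      ENNReal.ofReal ‖u‖ := by
    intro j hj'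
    refine le_trans (le_of_eq ?_) (Hs.memLp_pow_mul_fourier (j := j) (by linarith [hj j hj']) u)
    have hmp := Measure.measurePreserving_neg (volume : Measure ℝ)
    rw [← eLpNorm_comp_measurePreserving (p := 2) (μ := volume) (ν := volume) ?_ hmp]
    · refine eLpNorm_congr_norm_ae (Filter.Eventually.of_forall fun ξ => ?_)
      simp [hg, hû, abs_mul]
    · exact hmeas j
  have hML : ∀ j ≤ n, MemLp (fun ξ : ℝ => (-2 * Real.pi * Complex.I * ξ : ℂ) ^ j • g ξ) 2 volume :=
    fun j hj' => ⟨(hint j hj').1, (hL j hj').trans_lt ENNReal.ofReal_lt_top⟩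
  set U : ℝ → ℂ := 𝓕 g with hU
  have hUd : ∀ j ≤ n, iteratedDeriv j U =
      𝓕 (fun ξ : ℝ => (-2 * Real.pi * Complex.I * ξ : ℂ) ^ j • g ξ) := fun j hj' =>
    Real.iteratedDeriv_fourier hint' (by exact_mod_cast hj')
  have hUc : ContDiff ℝ n U := by
    have := Real.contDiff_fourier (f := g) (N := n) fun j hj' => by
      have := (hint' j hj').norm
      refine this.congr (Filter.Eventually.of_forall fun ξ => ?_)
      simp
    exact_mod_cast this
  have hg1 : Integrable û := by
    have h := (hC 0 (Nat.zero_le _) u).1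
    refine (integrable_norm_iff hûm.1).1 (by simpa using h)
  have hUae : (fun x => (u x : ℂ)) =ᵐ[volume] U := by
    have h1 := fourierInv_toLp_ae_eq hg1 hûm
    rw [Lp.toLp_coeFn] at h1
    have h2 : (𝓕⁻ (fourierL2 (Hs.toL2 u)) : Lp ℂ 2 (volume : Measure ℝ)) =
        complexify (Hs.toL2 u) := FourierTransform.fourierInv_fourier_eq _
    rw [h2] at h1
    have h3 : 𝓕⁻ û = U := Real.fourierInv_eq_fourier_comp_neg û
    rw [h3] at h1
    exact (complexify_ae _).symm.trans h1
  set w : ℝ → ℝ := fun x => (U x).re with hw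
  have hwc : ContDiff ℝ n w := Complex.reCLM.contDiff.comp hUc
  have hwd : ∀ j ≤ n, ∀ x, iteratedDeriv j w x = (iteratedDeriv j U x).re := by
    intro j hj' x
    have := Complex.reCLM.iteratedFDeriv_comp_left (f := U) (n := n) (i := j) hUc.contDiffAt
      (x := x) (by exact_mod_cast hj')
    rw [iteratedDeriv_eq_iteratedFDeriv, iteratedDeriv_eq_iteratedFDeriv]
    change iteratedFDeriv ℝ j (Complex.reCLM ∘ U) x _ = _
    rw [this]
    rfl
  refine ⟨w, ?_, hwc, fun j hj' => ?_⟩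
  · filter_upwards [hUae] with x hx
    simp [hw, ← hx]
  have hle : ∀ x, ‖iteratedDeriv j w x‖ ≤ ‖iteratedDeriv j U x‖ := fun x => by
    rw [hwd j hj']
    exact Complex.abs_re_le_norm _
  have hUL : eLpNorm (iteratedDeriv j U) 2 volume ≤ ENNReal.ofReal ‖u‖ := by
    rw [hUd j hj', eLpNorm_fourier (hint j hj') (hML j hj')]
    exact hL j hj'
  have hwL : eLpNorm (iteratedDeriv j w) 2 volume ≤ ENNReal.ofReal ‖u‖ :=
    (eLpNorm_mono hle).trans hUL
  refine ⟨fun x => ?_, ⟨?_, hwL.trans_lt ENNReal.ofReal_lt_top⟩, hwL⟩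
  · refine (hle x).trans ?_
    rw [hUd j hj', Real.fourier_eq]
    refine (norm_integral_le_integral_norm _).trans ?_
    have h1 : ∫ ξ, ‖Real.fourierChar (-(inner ℝ ξ x)) •
        ((-2 * Real.pi * Complex.I * ξ : ℂ) ^ j • g ξ)‖ =
        ∫ ξ, |2 * Real.pi * ξ| ^ j * ‖û ξ‖ := by
      rw [← integral_neg_eq_self]
      refine integral_congr_ae (Filter.Eventually.of_forall fun ξ => ?_)
      simp [hg, abs_mul, Circle.norm_smul]
    rw [h1]
    refine ((hC j hj' u).2).trans ?_
    gcongr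
    exact Finset.single_le_sum (f := C) (fun i hi => hC0 i (by simpa [Nat.lt_succ_iff] using hi))
      (by simpa [Nat.lt_succ_iff] using hj')
  · exact (hwc.continuous_iteratedDeriv j (by exact_mod_cast hj')).aestronglyMeasurable

/-! ### Convolution of `L²` functions with finite measures -/

section MeasureConvolution

variable {h : ℝ → ℝ} (ν : Measure ℝ) [IsFiniteMeasure ν]

lemma memLp_sub_prod (hh : MemLp h 2 volume) :
    MemLp (fun p : ℝ × ℝ => h (p.1 - p.2)) 2 (volume.prod ν) :=
  (hh.comp_fst ν).comp_measurePreserving (measurePreserving_sub_prod volume ν)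

lemma ae_integrable_comp_sub (hh : MemLp h 2 volume) :
    ∀ᵐ x, Integrable (fun y => h (x - y)) ν := by
  have h1 := memLp_sub_prod ν hh
  have h2 := h1.integrable_sq.prod_right_ae
  have h3 := h1.1.prodMk_left
  filter_upwards [h2, h3] with x hx hx'
  have : MemLp (fun y => h (x - y)) 2 ν := (memLp_two_iff_integrable_sq hx').2 hx
  exact this.integrable (by norm_num)

lemma memLp_measureConv (hh : MemLp h 2 volume) :
    MemLp (fun x => ∫ y, h (x - y) ∂ν) 2 volume := by
  have h1 := memLp_sub_prod ν hh
  have hm : AEStronglyMeasurable (fun x => ∫ y, h (x - y) ∂ν) volume :=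
    h1.1.integral_prod_right'
  rw [memLp_two_iff_integrable_sq hm]
  have h2 := h1.integrable_sq
  have h4 := (h2.integral_prod_left).const_mul (ν.real univ)
  refine h4.mono' (hm.pow 2) ?_
  filter_upwards [h2.prod_right_ae, h1.1.prodMk_left] with x hx hx'
  have hL : MemLp (fun y => h (x - y)) 2 ν := (memLp_two_iff_integrable_sq hx').2 hx
  rw [Real.norm_of_nonneg (sq_nonneg _)]
  set a := ∫ y, h (x - y) ∂ν
  set m := ν.real univ
  have hm0 : 0 ≤ m := measureReal_nonneg
  have hi := hL.integrable (by norm_num)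
  have key : 0 ≤ ∫ y, (m * h (x - y) - a) ^ 2 ∂ν := integral_nonneg fun y => sq_nonneg _
  have e : ∫ y, (m * h (x - y) - a) ^ 2 ∂ν = m ^ 2 * ∫ y, h (x - y) ^ 2 ∂ν - m * a ^ 2 := by
    have : (fun y => (m * h (x - y) - a) ^ 2) =
        fun y => (m ^ 2 * h (x - y) ^ 2 - 2 * m * a * h (x - y)) + a ^ 2 := by
      funext y; ring
    have i1 : Integrable (fun y => m ^ 2 * h (x - y) ^ 2 - 2 * m * a * h (x - y)) ν :=
      (hx.const_mul _).sub (hi.const_mul _)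
    rw [this, integral_add i1 (integrable_const _),
      integral_sub (hx.const_mul _) (hi.const_mul _), integral_const_mul, integral_const_mul,
      integral_const, smul_eq_mul]
    change m ^ 2 * _ - 2 * m * a * a + m * a ^ 2 = _
    ring
  rw [e] at key
  rcases hm0.eq_or_lt with h0 | h0
  · have : ν = 0 := by
      have := h0.symm
      rwa [measureReal_eq_zero_iff, Measure.measure_univ_eq_zero] at this
    simp [a, this]
  · have : m * (m * ∫ y, h (x - y) ^ 2 ∂ν) ≥ m * a ^ 2 := by nlinarith
    exact le_of_mul_le_mul_left this h0

/-- The Fourier transform of `ν ∗ h`. -/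
lemma fourierL2_measureConv (u v : Lp ℝ 2 (volume : Measure ℝ)) (hh : MemLp h 2 volume)
    (hu : u =ᵐ[volume] h) (hv : v =ᵐ[volume] fun x => ∫ y, h (x - y) ∂ν) :
    fourierL2 v =ᵐ[volume] fun ξ => charFun ν (-(2 * Real.pi * ξ)) * fourierL2 u ξ := by
  have hcm : Measurable fun ξ : ℝ => charFun ν (-(2 * Real.pi * ξ)) :=
    measurable_charFun.comp (by fun_prop)
  have hg2 : MemLp (fun ξ : ℝ => charFun ν (-(2 * Real.pi * ξ)) * fourierL2 u ξ) 2 volume := by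
    refine (Lp.memLp (fourierL2 u)).of_le_mul (c := ν.real univ)
      (hcm.aestronglyMeasurable.mul (Lp.aestronglyMeasurable _))
      (Filter.Eventually.of_forall fun ξ => ?_)
    rw [norm_mul]
    gcongr
    exact norm_charFun_le _
  refine fourierL2_ae_eq_of_test v (memLp_two_locallyIntegrable hg2) fun φ hφ => ?_
  set e : ℝ → ℝ → ℂ := fun ξ y => Complex.exp (-(2 * Real.pi * ξ * y * Complex.I)) with he
  have hen : ∀ ξ y, ‖e ξ y‖ = 1 := fun ξ y => by
    have : -(2 * Real.pi * ξ * y * Complex.I : ℂ) = ((-(2 * Real.pi * ξ * y) : ℝ) : ℂ) * Complex.I := by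
      push_cast; ring
    rw [he]
    simp only
    rw [this, Complex.norm_exp_ofReal_mul_I]
  have hec : Continuous (fun p : ℝ × ℝ => e p.1 p.2) := by
    simp only [he]; fun_prop
  have hφm : MemLp φ 2 volume := SchwartzMap.memLp _ _ _
  have hi1 : Integrable (fun ξ => φ ξ * fourierL2 u ξ) := hφm.integrable_mul (Lp.memLp _)
  have hi2 : Integrable (fun p : ℝ × ℝ => (φ p.1 * fourierL2 u p.1) * e p.1 p.2)
      (volume.prod ν) :=
    (hi1.comp_fst ν).mul_bdd (c := 1) hec.aestronglyMeasurable
      (Filter.Eventually.of_forall fun p => (hen _ _).le)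
  have s1 : ∫ ξ, φ ξ * (charFun ν (-(2 * Real.pi * ξ)) * fourierL2 u ξ) =
      ∫ y, ∫ ξ, (φ ξ * fourierL2 u ξ) * e ξ y ∂volume ∂ν := by
    rw [← integral_integral_swap hi2]
    refine integral_congr_ae (Filter.Eventually.of_forall fun ξ => ?_)
    simp only
    have h1 : charFun ν (-(2 * Real.pi * ξ)) = ∫ y, e ξ y ∂ν := by
      rw [charFun_apply_real]
      refine integral_congr_ae (Filter.Eventually.of_forall fun y => ?_)
      simp only [he]
      congr 1
      push_cast; ring
    rw [integral_const_mul, h1]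
    ring
  have s2 : ∀ y, ∫ ξ, (φ ξ * fourierL2 u ξ) * e ξ y = ∫ x, 𝓕 φ x * (h (x - y) : ℂ) := by
    intro y
    have hc : HasCompactSupport (fun ξ => φ ξ * e ξ y) := hφ.mul_right
    have hs : ContDiff ℝ ((⊤ : ℕ∞) : WithTop ℕ∞) (fun ξ => φ ξ * e ξ y) :=
      (φ.smooth _).mul (by
        have h1 : ContDiff ℝ ((⊤ : ℕ∞) : WithTop ℕ∞) fun ξ : ℝ => (ξ : ℂ) :=
          Complex.ofRealCLM.contDiff
        simp only [he]; fun_prop)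
    have := integral_mul_fourierL2 u (hc.toSchwartzMap hs)
    have e1 : ∫ ξ, (φ ξ * fourierL2 u ξ) * e ξ y =
        ∫ ξ, hc.toSchwartzMap hs ξ * fourierL2 u ξ := by
      refine integral_congr_ae (Filter.Eventually.of_forall fun ξ => ?_)
      change _ = (φ ξ * e ξ y) * _
      ring
    rw [e1, this, ← integral_sub_right_eq_self _ y]
    refine integral_congr_ae ?_
    have hq := (measurePreserving_sub_right (volume : Measure ℝ) y).quasiMeasurePreserving.ae_eq hu
    filter_upwards [hq] with x hx
    simp only [Function.comp] at hx
    rw [hx]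
    congr 1
    rw [SchwartzMap.fourier_coe, SchwartzMap.fourier_coe, Real.fourier_real_eq_integral_exp_smul,
      Real.fourier_real_eq_integral_exp_smul]
    refine integral_congr_ae (Filter.Eventually.of_forall fun ξ => ?_)
    change _ • (φ ξ * e ξ y) = _
    simp only [he, smul_eq_mul]
    rw [mul_comm (φ ξ), ← mul_assoc, ← Complex.exp_add]
    congr 2
    push_cast; ring
  have hF2 : MemLp (𝓕 φ : SchwartzMap ℝ ℂ) 2 volume := SchwartzMap.memLp _ _ _
  have hi3 : Integrable (fun p : ℝ × ℝ => 𝓕 φ p.1 * (h (p.1 - p.2) : ℂ)) (volume.prod ν) :=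
    (hF2.comp_fst ν).integrable_mul (memLp_sub_prod ν hh).ofReal
  rw [s1]
  simp only [s2]
  rw [← integral_integral_swap hi3]
  refine integral_congr_ae ?_
  filter_upwards [hv] with x hx
  rw [integral_const_mul, hx, integral_complex_ofReal]

end MeasureConvolution

lemma fourierL2_sub (u v : Lp ℝ 2 (volume : Measure ℝ)) :
    fourierL2 (u - v) = fourierL2 u - fourierL2 v := by
  have := fourierL2_smul (-1) v
  rw [sub_eq_add_neg, fourierL2_add, sub_eq_add_neg]
  simpa using this

/-- Convolution with a difference of two finite measures acts on `L²` as a Fourier multiplier. -/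
lemma exists_measureConv_sub (ν₁ ν₂ : Measure ℝ) [IsFiniteMeasure ν₁] [IsFiniteMeasure ν₂]
    {h : ℝ → ℝ} (hh : MemLp h 2 volume) (u : Lp ℝ 2 (volume : Measure ℝ)) (hu : u =ᵐ[volume] h) :
    ∃ v : Lp ℝ 2 (volume : Measure ℝ),
      (v =ᵐ[volume] fun x => ∫ y, h (x - y) ∂ν₁ - ∫ y, h (x - y) ∂ν₂) ∧
      fourierL2 v =ᵐ[volume] fun ξ =>
        (charFun ν₁ (-(2 * Real.pi * ξ)) - charFun ν₂ (-(2 * Real.pi * ξ))) * fourierL2 u ξ := by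
  have h1 := memLp_measureConv ν₁ hh
  have h2 := memLp_measureConv ν₂ hh
  refine ⟨h1.toLp - h2.toLp, ?_, ?_⟩
  · filter_upwards [Lp.coeFn_sub h1.toLp h2.toLp, h1.coeFn_toLp, h2.coeFn_toLp] with x e1 e2 e3
    rw [e1, Pi.sub_apply, e2, e3]
  · rw [fourierL2_sub]
    filter_upwards [Lp.coeFn_sub (fourierL2 h1.toLp) (fourierL2 h2.toLp),
      fourierL2_measureConv ν₁ u _ hh hu h1.coeFn_toLp,
      fourierL2_measureConv ν₂ u _ hh hu h2.coeFn_toLp] with x e1 e2 e3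
    rw [e1, Pi.sub_apply, e2, e3, sub_mul]

/-! ### Fourier symbols of the kernels -/

/-- `ν₁ - ν₂` is the distributional derivative of `g`. -/
def HasMeasureDeriv (g : ℝ → ℝ) (ν₁ ν₂ : Measure ℝ) : Prop :=
  ∀ η : ℝ → ℝ, ContDiff ℝ ((⊤ : ℕ∞) : WithTop ℕ∞) η → HasCompactSupport η →
    ∫ x, g x * deriv η x = -(∫ x, η x ∂ν₁ - ∫ x, η x ∂ν₂)

lemma HasMeasureDeriv.of_bounded {g : ℝ → ℝ} {ν₁ ν₂ : Measure ℝ} [IsFiniteMeasure ν₁]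
    [IsFiniteMeasure ν₂] (hg : Integrable g) (h : HasMeasureDeriv g ν₁ ν₂)
    {η : ℝ → ℝ} (hη : ContDiff ℝ ((⊤ : ℕ∞) : WithTop ℕ∞) η) {B B' : ℝ} (hB : ∀ x, |η x| ≤ B)
    (hB' : ∀ x, |deriv η x| ≤ B') :
    ∫ x, g x * deriv η x = -(∫ x, η x ∂ν₁ - ∫ x, η x ∂ν₂) := by
  have hB0 : 0 ≤ B := (abs_nonneg _).trans (hB 0)
  let χ : ContDiffBump (0 : ℝ) := ⟨1, 2, by norm_num, by norm_num⟩
  have hχc : ContDiff ℝ ((⊤ : ℕ∞) : WithTop ℕ∞) χ := χ.contDiff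
  have hχd : Continuous (deriv χ) := hχc.continuous_deriv (by simp)
  obtain ⟨D, hD⟩ := χ.hasCompactSupport.deriv.exists_bound_of_continuous hχd
  have hD0 : 0 ≤ D := (norm_nonneg _).trans (hD 0)
  have hχ1 : ∀ x, |χ x| ≤ 1 := fun x => by
    rw [abs_of_nonneg χ.nonneg]; exact χ.le_one
  set c : ℕ → ℝ := fun k => 1 / ((k : ℝ) + 1) with hc
  have hcpos : ∀ k, 0 < c k := fun k => by simp only [hc]; positivity
  have hc1 : ∀ k, c k ≤ 1 := fun k => by
    simp only [hc]; rw [div_le_one (by positivity)]; linarith [(Nat.cast_nonneg k : (0 : ℝ) ≤ k)]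
  have hct : Filter.Tendsto c Filter.atTop (nhds 0) := tendsto_one_div_add_atTop_nhds_zero_nat
  have hχt : ∀ x, Filter.Tendsto (fun k => χ (c k * x)) Filter.atTop (nhds 1) := by
    intro x
    have h0 : χ (0 * x) = 1 := by
      rw [zero_mul]; exact χ.one_of_mem_closedBall (by simp [χ.rIn_pos.le])
    rw [← h0]
    exact (χ.continuous.tendsto _).comp (hct.mul_const x)
  set ζ : ℕ → ℝ → ℝ := fun k x => χ (c k * x) * η x with hζ
  have hζs : ∀ k, ContDiff ℝ ((⊤ : ℕ∞) : WithTop ℕ∞) (ζ k) := fun k =>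
    (hχc.comp (contDiff_const.mul contDiff_id)).mul hη
  have hζc : ∀ k, HasCompactSupport (ζ k) := fun k => by
    refine HasCompactSupport.mul_right ?_
    exact χ.hasCompactSupport.comp_homeomorph (Homeomorph.mulLeft₀ (c k) (hcpos k).ne')
  have hηd : ∀ x, HasDerivAt η (deriv η x) x := fun x =>
    (hη.differentiable (by simp) x).hasDerivAt
  have hζd : ∀ k x, deriv (ζ k) x = c k * deriv χ (c k * x) * η x + χ (c k * x) * deriv η x := by
    intro k x
    have h1 : HasDerivAt (fun x => χ (c k * x)) (c k * deriv χ (c k * x)) x := by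
      have h2 : HasDerivAt χ (deriv χ (c k * x)) (c k * x) :=
        (hχc.differentiable (by simp) _).hasDerivAt
      have h3 : HasDerivAt (fun x => c k * x) (c k) x := by
        simpa using (hasDerivAt_id x).const_mul (c k)
      rw [mul_comm]
      exact h2.comp x h3
    exact (h1.mul (hηd x)).deriv
  have T0 : Filter.Tendsto (fun k => ∫ x, g x * deriv (ζ k) x) Filter.atTop
      (nhds (∫ x, g x * deriv η x)) := by
    refine tendsto_integral_of_dominated_convergence (fun x => ‖g x‖ * (D * B + B')) (fun k => ?_)
      (hg.norm.mul_const _) (fun k => Filter.Eventually.of_forall fun x => ?_)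
      (Filter.Eventually.of_forall fun x => ?_)
    · exact hg.1.mul ((hζs k).continuous_deriv (by simp)).aestronglyMeasurable
    · rw [norm_mul, hζd]
      gcongr
      refine (norm_add_le _ _).trans ?_
      gcongr
      · rw [norm_mul, norm_mul, Real.norm_of_nonneg (hcpos k).le]
        calc c k * ‖deriv χ (c k * x)‖ * ‖η x‖ ≤ 1 * D * B := by
              gcongr
              · exact hc1 k
              · exact hD _
              · exact hB x
          _ = D * B := by ring
      · rw [norm_mul]
        calc ‖χ (c k * x)‖ * ‖deriv η x‖ ≤ 1 * B' := by
              gcongr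
              · exact hχ1 _
              · exact hB' x
          _ = B' := one_mul _
    · simp only [hζd]
      have t1 : Filter.Tendsto (fun k => c k * deriv χ (c k * x) * η x) Filter.atTop
          (nhds (0 * deriv χ (0 * x) * η x)) :=
        (hct.mul ((hχd.tendsto _).comp (hct.mul_const x))).mul_const _
      have t2 := (t1.add ((hχt x).mul_const (deriv η x))).const_mul (g x)
      simpa using t2
  have T1 : ∀ (ν : Measure ℝ) [IsFiniteMeasure ν],
      Filter.Tendsto (fun k => ∫ x, ζ k x ∂ν) Filter.atTop (nhds (∫ x, η x ∂ν)) := by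
    intro ν _
    refine tendsto_integral_of_dominated_convergence (fun _ => B) (fun k => ?_)
      (integrable_const _) (fun k => Filter.Eventually.of_forall fun x => ?_)
      (Filter.Eventually.of_forall fun x => ?_)
    · exact (hζs k).continuous.aestronglyMeasurable
    · rw [norm_mul]
      calc ‖χ (c k * x)‖ * ‖η x‖ ≤ 1 * B := by
            gcongr
            · exact hχ1 _
            · exact hB x
        _ = B := one_mul _
    · simpa using (hχt x).mul_const (η x)
  refine tendsto_nhds_unique T0 ?_
  simp only [h _ (hζs _) (hζc _)]
  exact ((T1 ν₁).sub (T1 ν₂)).neg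

/-- The Fourier transform of a distributional derivative. -/
lemma HasMeasureDeriv.charFun_sub {g : ℝ → ℝ} {ν₁ ν₂ : Measure ℝ} [IsFiniteMeasure ν₁]
    [IsFiniteMeasure ν₂] (hg : Integrable g) (h : HasMeasureDeriv g ν₁ ν₂) (ξ : ℝ) :
    charFun ν₁ (-(2 * Real.pi * ξ)) - charFun ν₂ (-(2 * Real.pi * ξ)) =
      2 * Real.pi * Complex.I * ξ * 𝓕 (fun x => (g x : ℂ)) ξ := by
  set a : ℝ := 2 * Real.pi * ξ with ha
  have hcos : ∀ x, HasDerivAt (fun x => Real.cos (a * x)) (-(a * Real.sin (a * x))) x := fun x => by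
    have := (Real.hasDerivAt_cos (a * x)).comp x ((hasDerivAt_id x).const_mul a)
    simpa [mul_comm, Function.comp_def] using this
  have hsin : ∀ x, HasDerivAt (fun x => Real.sin (a * x)) (a * Real.cos (a * x)) x := fun x => by
    have := (Real.hasDerivAt_sin (a * x)).comp x ((hasDerivAt_id x).const_mul a)
    simpa [mul_comm, Function.comp_def] using this
  have e1 := h.of_bounded hg (η := fun x => Real.cos (a * x)) (B := 1) (B' := |a|)
    (Real.contDiff_cos.comp (contDiff_const.mul contDiff_id)) (fun x => Real.abs_cos_le_one _)
    (fun x => by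
      rw [(hcos x).deriv, abs_neg, abs_mul]
      exact mul_le_of_le_one_right (abs_nonneg _) (Real.abs_sin_le_one _))
  have e2 := h.of_bounded hg (η := fun x => Real.sin (a * x)) (B := 1) (B' := |a|)
    (Real.contDiff_sin.comp (contDiff_const.mul contDiff_id)) (fun x => Real.abs_sin_le_one _)
    (fun x => by
      rw [(hsin x).deriv, abs_mul]
      exact mul_le_of_le_one_right (abs_nonneg _) (Real.abs_cos_le_one _))
  simp only [(hcos _).deriv] at e1
  simp only [(hsin _).deriv] at e2
  have hcs : ∀ x : ℝ, Complex.exp (((-a : ℝ) : ℂ) * x * Complex.I) =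
      ((Real.cos (a * x) : ℝ) : ℂ) - ((Real.sin (a * x) : ℝ) : ℂ) * Complex.I := by
    intro x
    have : ((-a : ℝ) : ℂ) * x * Complex.I = ((-(a * x) : ℝ) : ℂ) * Complex.I := by push_cast; ring
    rw [this, Complex.exp_mul_I, ← Complex.ofReal_cos, ← Complex.ofReal_sin, Real.cos_neg,
      Real.sin_neg]
    push_cast; ring
  have hch : ∀ (ν : Measure ℝ) [IsFiniteMeasure ν], charFun ν (-a) =
      ((∫ x, Real.cos (a * x) ∂ν : ℝ) : ℂ) - ((∫ x, Real.sin (a * x) ∂ν : ℝ) : ℂ) * Complex.I := by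
    intro ν _
    have ic : Integrable (fun x => Real.cos (a * x)) ν :=
      Integrable.of_bound (C := 1) (Continuous.aestronglyMeasurable (by fun_prop))
        (Filter.Eventually.of_forall fun x => Real.abs_cos_le_one _)
    have is : Integrable (fun x => Real.sin (a * x)) ν :=
      Integrable.of_bound (C := 1) (Continuous.aestronglyMeasurable (by fun_prop))
        (Filter.Eventually.of_forall fun x => Real.abs_sin_le_one _)
    rw [charFun_apply_real]
    simp only [hcs]
    rw [integral_sub ic.ofReal (is.ofReal.mul_const _), integral_mul_const, integral_complex_ofReal,
      integral_complex_ofReal]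
  have hF : 𝓕 (fun x => (g x : ℂ)) ξ = ((∫ x, g x * Real.cos (a * x) : ℝ) : ℂ) -
      ((∫ x, g x * Real.sin (a * x) : ℝ) : ℂ) * Complex.I := by
    have ic : Integrable (fun x => g x * Real.cos (a * x)) :=
      hg.mul_bdd (c := 1) (Continuous.aestronglyMeasurable (by fun_prop))
        (Filter.Eventually.of_forall fun x => Real.abs_cos_le_one _)
    have is : Integrable (fun x => g x * Real.sin (a * x)) :=
      hg.mul_bdd (c := 1) (Continuous.aestronglyMeasurable (by fun_prop))
        (Filter.Eventually.of_forall fun x => Real.abs_sin_le_one _)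
    rw [Real.fourier_real_eq_integral_exp_smul]
    rw [← integral_complex_ofReal, ← integral_complex_ofReal, ← integral_mul_const,
      ← integral_sub ic.ofReal (is.ofReal.mul_const _)]
    refine integral_congr_ae (Filter.Eventually.of_forall fun x => ?_)
    have := hcs x
    simp only [smul_eq_mul]
    rw [show ((-2 * Real.pi * x * ξ : ℝ) : ℂ) * Complex.I = ((-a : ℝ) : ℂ) * x * Complex.I by
      rw [ha]; push_cast; ring, this]
    push_cast; ring
  have f1 : ∫ x, g x * -(a * Real.sin (a * x)) = -(a * ∫ x, g x * Real.sin (a * x)) := by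
    rw [← integral_const_mul, ← integral_neg]
    refine integral_congr_ae (Filter.Eventually.of_forall fun x => ?_)
    simp only; ring
  have f2 : ∫ x, g x * (a * Real.cos (a * x)) = a * ∫ x, g x * Real.cos (a * x) := by
    rw [← integral_const_mul]
    refine integral_congr_ae (Filter.Eventually.of_forall fun x => ?_)
    simp only; ring
  rw [f1] at e1
  rw [f2] at e2
  rw [hch ν₁, hch ν₂, hF]
  have g1 := congrArg (fun r : ℝ => (r : ℂ)) e1
  have g2 := congrArg (fun r : ℝ => (r : ℂ)) e2
  have hac : (2 * Real.pi * Complex.I * ξ : ℂ) = (a : ℂ) * Complex.I := by rw [ha]; push_cast; ring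
  rw [hac]
  push_cast at g1 g2 ⊢
  linear_combination g1 - Complex.I * g2 + (a * ∫ x, g x * Real.sin (a * x) : ℂ) * Complex.I_sq

/-! ### Signed densities and signed measures -/

/-- The positive part of `g dx`. -/
def posMeasure (g : ℝ → ℝ) : Measure ℝ := volume.withDensity fun x => ENNReal.ofReal (g x)

lemma isFiniteMeasure_posMeasure {g : ℝ → ℝ} (hg : Integrable g) :
    IsFiniteMeasure (posMeasure g) :=
  isFiniteMeasure_withDensity_ofReal hg.2

lemma integral_posMeasure {E : Type*} [NormedAddCommGroup E] [NormedSpace ℝ E] {g : ℝ → ℝ}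
    (hg : Integrable g) (η : ℝ → E) :
    ∫ x, η x ∂posMeasure g = ∫ x, max (g x) 0 • η x := by
  rw [posMeasure, integral_withDensity_eq_integral_toReal_smul₀ hg.1.aemeasurable.ennreal_ofReal
    (Filter.Eventually.of_forall fun x => ENNReal.ofReal_lt_top)]
  simp only [ENNReal.toReal_ofReal']

lemma integrable_posMeasure_iff {E : Type*} [NormedAddCommGroup E] [NormedSpace ℝ E] {g : ℝ → ℝ}
    (hg : Integrable g) (η : ℝ → E) :
    Integrable η (posMeasure g) ↔ Integrable fun x => max (g x) 0 • η x := by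
  rw [posMeasure, integrable_withDensity_iff_integrable_smul₀' hg.1.aemeasurable.ennreal_ofReal
    (Filter.Eventually.of_forall fun x => ENNReal.ofReal_lt_top)]
  simp only [ENNReal.toReal_ofReal']

lemma integral_posMeasure_sub {E : Type*} [NormedAddCommGroup E] [NormedSpace ℝ E] {g : ℝ → ℝ}
    (hg : Integrable g) {η : ℝ → E} (h₁ : Integrable η (posMeasure g))
    (h₂ : Integrable η (posMeasure (-g))) :
    ∫ x, η x ∂posMeasure g - ∫ x, η x ∂posMeasure (-g) = ∫ x, g x • η x := by
  rw [integrable_posMeasure_iff hg] at h₁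
  rw [integrable_posMeasure_iff hg.neg] at h₂
  rw [integral_posMeasure hg, integral_posMeasure hg.neg, ← integral_sub h₁ h₂]
  refine integral_congr_ae (Filter.Eventually.of_forall fun x => ?_)
  simp only [← sub_smul, Pi.neg_apply]
  congr 1
  rcases le_total (g x) 0 with h | h
  · rw [max_eq_right h, max_eq_left (by linarith)]; ring
  · rw [max_eq_left h, max_eq_right (by linarith)]; ring

lemma charFun_posMeasure_sub {g : ℝ → ℝ} (hg : Integrable g) (ξ : ℝ) :
    charFun (posMeasure g) (-(2 * Real.pi * ξ)) - charFun (posMeasure (-g)) (-(2 * Real.pi * ξ)) =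
      𝓕 (fun x => (g x : ℂ)) ξ := by
  have := isFiniteMeasure_posMeasure hg
  have := isFiniteMeasure_posMeasure hg.neg
  have hi : ∀ (ν : Measure ℝ) [IsFiniteMeasure ν],
      Integrable (fun x : ℝ => Complex.exp (((-(2 * Real.pi * ξ) : ℝ) : ℂ) * x * Complex.I)) ν := by
    intro ν _
    refine Integrable.of_bound (C := 1) (Continuous.aestronglyMeasurable (by fun_prop))
      (Filter.Eventually.of_forall fun x => ?_)
    rw [← Complex.ofReal_mul, Complex.norm_exp_ofReal_mul_I]
  rw [charFun_apply_real, charFun_apply_real, integral_posMeasure_sub hg (hi _) (hi _),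
    Real.fourier_real_eq_integral_exp_smul]
  refine integral_congr_ae (Filter.Eventually.of_forall fun x => ?_)
  simp only [Complex.real_smul, smul_eq_mul]
  rw [mul_comm]
  congr 2
  push_cast; ring

lemma IsWeakDeriv.hasMeasureDeriv {g g' : ℝ → ℝ} (hg' : Integrable g') (h : IsWeakDeriv g g') :
    HasMeasureDeriv g (posMeasure g') (posMeasure (-g')) := by
  intro η hη hc
  have := isFiniteMeasure_posMeasure hg'
  have := isFiniteMeasure_posMeasure hg'.neg
  obtain ⟨B, hB⟩ := hc.exists_bound_of_continuous hη.continuous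
  have hi : ∀ (ν : Measure ℝ) [IsFiniteMeasure ν], Integrable η ν := fun ν _ =>
    Integrable.of_bound (C := B) hη.continuous.aestronglyMeasurable
      (Filter.Eventually.of_forall hB)
  rw [integral_posMeasure_sub hg' (hi _) (hi _), h η hη hc]
  simp

lemma integral_signedMeasure (μ : SignedMeasure ℝ) {η : ℝ → ℝ}
    (h₁ : Integrable η μ.toJordanDecomposition.posPart)
    (h₂ : Integrable η μ.toJordanDecomposition.negPart) :
    ∫ᵛ x, η x ∂•μ = ∫ x, η x ∂μ.toJordanDecomposition.posPart -
      ∫ x, η x ∂μ.toJordanDecomposition.negPart := by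
  have hfl : (ContinuousLinearMap.lsmul ℝ ℝ : ℝ →L[ℝ] ℝ →L[ℝ] ℝ) =
      (ContinuousLinearMap.lsmul ℝ ℝ).flip := by
    ext; simp
  conv_lhs => rw [← μ.toSignedMeasure_toJordanDecomposition, JordanDecomposition.toSignedMeasure]
  rw [VectorMeasure.integral_sub_vectorMeasure
    (by rwa [VectorMeasure.Integrable, Measure.variation_toSignedMeasure])
    (by rwa [VectorMeasure.Integrable, Measure.variation_toSignedMeasure]), hfl,
    VectorMeasure.integral_toSignedMeasure, VectorMeasure.integral_toSignedMeasure]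

lemma CondC2.hasMeasureDeriv {g : ℝ → ℝ} {μ : SignedMeasure ℝ} (h : CondC2 g μ) :
    HasMeasureDeriv g μ.toJordanDecomposition.posPart μ.toJordanDecomposition.negPart := by
  intro η hη hc
  obtain ⟨B, hB⟩ := hc.exists_bound_of_continuous hη.continuous
  have hi : ∀ (ν : Measure ℝ) [IsFiniteMeasure ν], Integrable η ν := fun ν _ =>
    Integrable.of_bound (C := B) hη.continuous.aestronglyMeasurable
      (Filter.Eventually.of_forall hB)
  rw [h η hη hc, integral_signedMeasure μ (hi _) (hi _)]

/-- The Fourier symbol of a signed measure. -/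
def symbol (μ : SignedMeasure ℝ) (ξ : ℝ) : ℂ :=
  charFun μ.toJordanDecomposition.posPart (-(2 * Real.pi * ξ)) -
    charFun μ.toJordanDecomposition.negPart (-(2 * Real.pi * ξ))

lemma exists_norm_symbol_le (μ : SignedMeasure ℝ) : ∃ C : ℝ, 0 ≤ C ∧ ∀ ξ, ‖symbol μ ξ‖ ≤ C :=
  ⟨μ.toJordanDecomposition.posPart.real univ + μ.toJordanDecomposition.negPart.real univ,
    add_nonneg measureReal_nonneg measureReal_nonneg,
    fun _ => (norm_sub_le _ _).trans (add_le_add (norm_charFun_le _) (norm_charFun_le _))⟩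

/-- Convolution with `α'` gains two derivatives. -/
lemma exists_weight_two_mul_fourier_le {α α' α'' : ℝ → ℝ} {μ : SignedMeasure ℝ}
    (hC1 : CondC1 α α' α'') (hC2 : CondC2 α'' μ) :
    ∃ C : ℝ, 0 ≤ C ∧ ∀ ξ, weight 2 ξ * ‖𝓕 (fun x => (α' x : ℂ)) ξ‖ ≤ C := by
  obtain ⟨C, hC0, hC⟩ := exists_norm_symbol_le μ
  have := isFiniteMeasure_posMeasure hC1.integrable_deriv2
  have := isFiniteMeasure_posMeasure hC1.integrable_deriv2.neg
  refine ⟨(∫ x, ‖α' x‖) + C, add_nonneg (integral_nonneg fun _ => norm_nonneg _) hC0, fun ξ => ?_⟩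
  have h1 := (hC1.weakDeriv2.hasMeasureDeriv hC1.integrable_deriv2).charFun_sub
    hC1.integrable_deriv ξ
  rw [charFun_posMeasure_sub hC1.integrable_deriv2] at h1
  have h2 := hC2.hasMeasureDeriv.charFun_sub hC1.integrable_deriv2 ξ
  rw [h1] at h2
  have h3 : (2 * Real.pi * ξ) ^ 2 * ‖𝓕 (fun x => (α' x : ℂ)) ξ‖ ≤ C := by
    refine le_trans (le_of_eq ?_) (hC ξ)
    rw [symbol, h2]
    simp only [norm_mul, Complex.norm_real, Complex.norm_I, Complex.norm_ofNat, Real.norm_eq_abs]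
    rw [← sq_abs, abs_mul, abs_mul, abs_two]
    ring
  have h4 : ‖𝓕 (fun x => (α' x : ℂ)) ξ‖ ≤ ∫ x, ‖α' x‖ := by
    rw [Real.fourier_eq]
    refine (norm_integral_le_integral_norm _).trans (le_of_eq ?_)
    simp [Circle.norm_smul]
  have h5 : weight 2 ξ = 1 + (2 * Real.pi * ξ) ^ 2 := by
    simp [weight]
  rw [h5, add_mul, one_mul]
  exact add_le_add h4 h3

/-- Convolution with an integrable function acts on `L²` as a Fourier multiplier. -/
lemma exists_convolution {g : ℝ → ℝ} (hg : Integrable g) {h : ℝ → ℝ} (hh : MemLp h 2 volume)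
    (u : Lp ℝ 2 (volume : Measure ℝ)) (hu : u =ᵐ[volume] h) :
    ∃ v : Lp ℝ 2 (volume : Measure ℝ),
      v =ᵐ[volume] (g ⋆[ContinuousLinearMap.mul ℝ ℝ, volume] h) ∧
      fourierL2 v =ᵐ[volume] fun ξ => 𝓕 (fun x => (g x : ℂ)) ξ * fourierL2 u ξ := by
  have := isFiniteMeasure_posMeasure hg
  have := isFiniteMeasure_posMeasure hg.neg
  obtain ⟨v, hv, hv'⟩ := exists_measureConv_sub (posMeasure g) (posMeasure (-g)) hh u hu
  refine ⟨v, ?_, ?_⟩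
  · filter_upwards [hv, ae_integrable_comp_sub (posMeasure g) hh,
      ae_integrable_comp_sub (posMeasure (-g)) hh] with x h1 h2 h3
    rw [h1, integral_posMeasure_sub hg h2 h3]
    rfl
  · simpa only [charFun_posMeasure_sub hg] using hv'

lemma exists_signedMeasure_conv (μ : SignedMeasure ℝ) (u : Lp ℝ 2 (volume : Measure ℝ)) :
    ∃ v : Lp ℝ 2 (volume : Measure ℝ),
      (v =ᵐ[volume] fun x => ∫ᵛ y, u (x - y) ∂•μ) ∧
      fourierL2 v =ᵐ[volume] fun ξ => symbol μ ξ * fourierL2 u ξ := by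
  obtain ⟨v, hv, hv'⟩ := exists_measureConv_sub μ.toJordanDecomposition.posPart
    μ.toJordanDecomposition.negPart (Lp.memLp u) u (ae_eq_refl _)
  refine ⟨v, ?_, hv'⟩
  filter_upwards [hv, ae_integrable_comp_sub μ.toJordanDecomposition.posPart (Lp.memLp u),
    ae_integrable_comp_sub μ.toJordanDecomposition.negPart (Lp.memLp u)] with x h1 h2 h3
  rw [h1, integral_signedMeasure μ h2 h3]

/-! ### Pointwise estimates for the derivatives of a composition -/

lemma exists_bound_on_Icc {g : ℝ → ℝ} (hg : Continuous g) (R : ℝ) :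
    ∃ C : ℝ, 0 ≤ C ∧ ∀ t, |t| ≤ R → |g t| ≤ C := by
  obtain ⟨C, hC⟩ := isCompact_Icc.exists_bound_of_continuousOn (s := Icc (-R) R) hg.continuousOn
  exact ⟨max C 0, le_max_right _ _, fun t ht => (hC t (abs_le.1 ht)).trans (le_max_left _ _)⟩

lemma exists_lipschitz_bound {f : ℝ → ℝ} (hf : ContDiff ℝ 1 f) (R : ℝ) :
    ∃ L : ℝ, 0 ≤ L ∧ ∀ a b, |a| ≤ R → |b| ≤ R → |f a - f b| ≤ L * |a - b| := by
  obtain ⟨L, hL0, hL⟩ := exists_bound_on_Icc (hf.continuous_deriv le_rfl) R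
  refine ⟨L, hL0, fun a b ha hb => ?_⟩
  exact (convex_Icc (-R) R).norm_image_sub_le_of_norm_deriv_le
    (fun x _ => hf.differentiable (by simp) x) (fun x hx => hL x (abs_le.2 hx))
    (abs_le.1 hb) (abs_le.1 ha)

lemma iteratedDeriv_succ_comp {n : ℕ} {f u : ℝ → ℝ} (hf : ContDiff ℝ (n + 1 : ℕ) f)
    (hu : ContDiff ℝ (n + 1 : ℕ) u) (x : ℝ) :
    iteratedDeriv (n + 1) (fun y => f (u y)) x = ∑ i ∈ Finset.range (n + 1),
      (n.choose i : ℝ) * iteratedDeriv i (fun y => deriv f (u y)) x *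
        iteratedDeriv (n - i + 1) u x := by
  have h1 : deriv (fun y => f (u y)) = (fun y => deriv f (u y)) * deriv u := by
    funext y
    have := ((hf.differentiable (by simp) (u y)).hasDerivAt.comp y
      (hu.differentiable (by simp) y).hasDerivAt).deriv
    simpa [Function.comp_def] using this
  have hu' : ContDiff ℝ n (deriv u) := by
    rw [Nat.cast_add, Nat.cast_one, contDiff_succ_iff_deriv] at hu; exact hu.2.2
  have hf' : ContDiff ℝ n (deriv f) := by
    rw [Nat.cast_add, Nat.cast_one, contDiff_succ_iff_deriv] at hf; exact hf.2.2
  have hc : ContDiff ℝ n (fun y => deriv f (u y)) :=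
    hf'.comp (hu.of_le (by exact_mod_cast Nat.le_succ n))
  rw [iteratedDeriv_succ', h1, iteratedDeriv_mul hc.contDiffAt hu'.contDiffAt]
  simp only [← iteratedDeriv_succ']

/-- The derivatives of `f ∘ u` at a point depend in a Lipschitz way on those of `u`. -/
lemma exists_iteratedDeriv_comp_sub_le (n : ℕ) : ∀ (f : ℝ → ℝ), ContDiff ℝ (n + 1 : ℕ) f →
    ∀ R : ℝ, 0 ≤ R → ∃ L : ℝ, 0 ≤ L ∧ ∀ u v : ℝ → ℝ, ContDiff ℝ n u → ContDiff ℝ n v → ∀ x,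
      (∀ i ≤ n, |iteratedDeriv i u x| ≤ R) → (∀ i ≤ n, |iteratedDeriv i v x| ≤ R) →
      |iteratedDeriv n (fun y => f (u y)) x - iteratedDeriv n (fun y => f (v y)) x| ≤
        L * ∑ i ∈ Finset.range (n + 1), |iteratedDeriv i u x - iteratedDeriv i v x| := by
  induction n using Nat.strong_induction_on with
  | _ n ih =>
  intro f hf R hR
  rcases n with _ | n
  · obtain ⟨L, hL0, hL⟩ := exists_lipschitz_bound (by simpa using hf) R
    refine ⟨L, hL0, fun u v _ _ x h1 h2 => ?_⟩
    simpa using hL _ _ (by simpa using h1 0 le_rfl) (by simpa using h2 0 le_rfl)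
  have hf' : ContDiff ℝ (n + 1 : ℕ) (deriv f) := by
    rw [Nat.cast_add, Nat.cast_one, contDiff_succ_iff_deriv] at hf; exact hf.2.2
  have hfi : ∀ i ≤ n, ContDiff ℝ (i + 1 : ℕ) (deriv f) := fun i hi =>
    hf'.of_le (by exact_mod_cast Nat.succ_le_succ hi)
  choose! L hL0 hL using fun i (hi : i ≤ n) =>
    ih i (Nat.lt_succ_of_le hi) (deriv f) (hfi i hi) R hR
  set K : ℕ → ℝ := fun i => L i * ((i + 1 : ℕ) * R) + |deriv f 0| with hK
  have hcomp : ∀ i ≤ n, ∀ v : ℝ → ℝ, ContDiff ℝ i v → ∀ x, (∀ k ≤ i, |iteratedDeriv k v x| ≤ R) →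
      |iteratedDeriv i (fun y => deriv f (v y)) x| ≤ K i := by
    intro i hi v hv x hx
    have h0 : ∀ k, iteratedDeriv k (fun _ : ℝ => (0 : ℝ)) x = 0 := fun k => by
      rw [iteratedDeriv_const]; simp
    have h1 := hL i hi v (fun _ => 0) hv contDiff_const x hx (fun k _ => by rw [h0]; simpa using hR)
    have h2 : |iteratedDeriv i (fun _ : ℝ => deriv f 0) x| ≤ |deriv f 0| := by
      rw [iteratedDeriv_const]
      split_ifs
      · rfl
      · simp
    have h3 : ∑ k ∈ Finset.range (i + 1),
        |iteratedDeriv k v x - iteratedDeriv k (fun _ : ℝ => (0 : ℝ)) x| ≤ (i + 1 : ℕ) * R := by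
      refine (Finset.sum_le_card_nsmul _ _ R fun k hk => ?_).trans (by simp)
      rw [h0, sub_zero]
      exact hx k (Nat.lt_succ_iff.1 (Finset.mem_range.1 hk))
    calc |iteratedDeriv i (fun y => deriv f (v y)) x|
        ≤ |iteratedDeriv i (fun y => deriv f (v y)) x - iteratedDeriv i (fun _ => deriv f 0) x| +
          |iteratedDeriv i (fun _ : ℝ => deriv f 0) x| := by
            simpa using abs_add_le (iteratedDeriv i (fun y => deriv f (v y)) x -
              iteratedDeriv i (fun _ => deriv f 0) x) (iteratedDeriv i (fun _ : ℝ => deriv f 0) x)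
      _ ≤ K i := add_le_add (h1.trans (mul_le_mul_of_nonneg_left h3 (hL0 i hi))) h2
  refine ⟨∑ i ∈ Finset.range (n + 1), (n.choose i : ℝ) * (L i * R + K i), ?_, ?_⟩
  · refine Finset.sum_nonneg fun i hi => ?_
    have := hL0 i (Nat.lt_succ_iff.1 (Finset.mem_range.1 hi))
    simp only [hK]
    positivity
  intro u v hu hv x hux hvx
  have hfn : ContDiff ℝ (n + 1 : ℕ) f := hf.of_le (by exact_mod_cast Nat.le_succ _)
  rw [iteratedDeriv_succ_comp hfn hu, iteratedDeriv_succ_comp hfn hv, ← Finset.sum_sub_distrib,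
    Finset.sum_mul]
  refine (Finset.abs_sum_le_sum_abs _ _).trans (Finset.sum_le_sum fun i hi => ?_)
  have hi' : i ≤ n := Nat.lt_succ_iff.1 (Finset.mem_range.1 hi)
  set S := ∑ k ∈ Finset.range (n + 1 + 1), |iteratedDeriv k u x - iteratedDeriv k v x| with hS
  set a := iteratedDeriv i (fun y => deriv f (u y)) x
  set a' := iteratedDeriv i (fun y => deriv f (v y)) x
  set b := iteratedDeriv (n - i + 1) u x
  set b' := iteratedDeriv (n - i + 1) v x
  have hiu : ContDiff ℝ i u := hu.of_le (by exact_mod_cast (by omega))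
  have hiv : ContDiff ℝ i v := hv.of_le (by exact_mod_cast (by omega))
  have ha : |a - a'| ≤ L i * S := by
    refine (hL i hi' u v hiu hiv x (fun k hk => hux k (by omega))
      (fun k hk => hvx k (by omega))).trans ?_
    refine mul_le_mul_of_nonneg_left ?_ (hL0 i hi')
    exact Finset.sum_le_sum_of_subset_of_nonneg (Finset.range_subset_range.2 (by omega))
      fun _ _ _ => abs_nonneg _
  have ha' : |a'| ≤ K i := hcomp i hi' v hiv x fun k hk => hvx k (by omega)
  have hb : |b| ≤ R := hux _ (by omega)
  have hb' : |b - b'| ≤ S :=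
    Finset.single_le_sum (f := fun k => |iteratedDeriv k u x - iteratedDeriv k v x|)
      (fun _ _ => abs_nonneg _) (Finset.mem_range.2 (by omega))
  have hS0 : 0 ≤ S := (abs_nonneg _).trans hb'
  have e : (n.choose i : ℝ) * a * b - (n.choose i : ℝ) * a' * b' =
      (n.choose i : ℝ) * ((a - a') * b + a' * (b - b')) := by ring
  rw [e, abs_mul, Nat.abs_cast, mul_assoc]
  refine mul_le_mul_of_nonneg_left ?_ (Nat.cast_nonneg _)
  refine (abs_add_le _ _).trans ?_
  rw [abs_mul, abs_mul]
  calc |a - a'| * |b| + |a'| * |b - b'| ≤ (L i * S) * R + K i * S := by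
        gcongr
        · exact (abs_nonneg _).trans ha
        · exact (abs_nonneg _).trans ha'
    _ = (L i * R + K i) * S := by ring

/-- A pointwise form of the Moser estimate. -/
lemma exists_iteratedDeriv_comp_le {n : ℕ} (hn : 1 ≤ n) {f : ℝ → ℝ} (hf : ContDiff ℝ n f) (M : ℝ) :
    ∃ C : ℝ, 0 ≤ C ∧ ∀ u : ℝ → ℝ, ContDiff ℝ n u → ∀ x, |u x| ≤ M →
      |iteratedDeriv n (fun y => f (u y)) x| ≤
        C * ∑ j ∈ Finset.Icc 1 n, |iteratedDeriv j u x| ^ ((n : ℝ) / j) := by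
  choose! c hc0 hc using fun i (hi : i ≤ n) =>
    exists_bound_on_Icc (hf.continuous_iteratedDeriv i (by exact_mod_cast hi)) M
  have hsum0 : ∀ i ∈ Finset.range (n + 1), 0 ≤ c i := fun i hi =>
    hc0 i (Nat.lt_succ_iff.1 (Finset.mem_range.1 hi))
  set C := ∑ i ∈ Finset.range (n + 1), c i with hC
  have hC0 : 0 ≤ C := Finset.sum_nonneg hsum0
  refine ⟨n.factorial * C, by positivity, fun u hu x hx => ?_⟩
  obtain ⟨j₀, hj₀, hmax⟩ := (Finset.Icc 1 n).exists_max_image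
    (fun j => |iteratedDeriv j u x| ^ ((1 : ℝ) / j)) ⟨1, by simp [hn]⟩
  set D := |iteratedDeriv j₀ u x| ^ ((1 : ℝ) / j₀) with hD
  have h1 := norm_iteratedFDeriv_comp_le hf hu le_rfl x (C := C) (D := D)
    (fun i hi => by
      rw [norm_iteratedFDeriv_eq_norm_iteratedDeriv]
      exact (hc i hi _ hx).trans
        (Finset.single_le_sum hsum0 (Finset.mem_range.2 (Nat.lt_succ_of_le hi))))
    (fun i hi hi' => by
      rw [norm_iteratedFDeriv_eq_norm_iteratedDeriv]
      have h2 := hmax i (Finset.mem_Icc.2 ⟨hi, hi'⟩)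
      have h3 := pow_le_pow_left₀ (by positivity) h2 i
      rwa [← Real.rpow_mul_natCast (abs_nonneg _), one_div,
        inv_mul_cancel₀ (by positivity), Real.rpow_one] at h3)
  rw [norm_iteratedFDeriv_eq_norm_iteratedDeriv] at h1
  refine h1.trans (mul_le_mul_of_nonneg_left ?_ (by positivity))
  have h2 : D ^ n = |iteratedDeriv j₀ u x| ^ ((n : ℝ) / j₀) := by
    rw [hD, ← Real.rpow_mul_natCast (abs_nonneg _)]
    congr 1; ring
  rw [h2]
  exact Finset.single_le_sum (f := fun j => |iteratedDeriv j u x| ^ ((n : ℝ) / j))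
    (fun j _ => by positivity) hj₀

/-! ### Gagliardo–Nirenberg inequalities -/

lemma hasDerivAt_abs_rpow_mul_self {p : ℝ} (hp : 0 < p) (t : ℝ) :
    HasDerivAt (fun t : ℝ => |t| ^ p * t) ((p + 1) * |t| ^ p) t := by
  rcases eq_or_ne t 0 with rfl | ht
  · rw [hasDerivAt_iff_tendsto_slope]
    have h0 : (p + 1) * |(0 : ℝ)| ^ p = |(0 : ℝ)| ^ p := by
      rw [abs_zero, Real.zero_rpow hp.ne']; simp
    rw [h0]
    have hc : Continuous fun t : ℝ => |t| ^ p := continuous_abs.rpow_const fun _ => Or.inr hp.le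
    refine ((hc.tendsto 0).mono_left nhdsWithin_le_nhds).congr' ?_
    filter_upwards [self_mem_nhdsWithin] with y hy
    have hy' : y ≠ 0 := hy
    rw [slope_def_field]
    simp [hp.ne', hy']
  · have h1 := ((hasDerivAt_abs ht).rpow_const (p := p) (Or.inl (abs_pos.2 ht).ne')).mul
      (hasDerivAt_id t)
    refine h1.congr_deriv ?_
    have h2 : |t| ^ p = |t| ^ (p - 1) * |t| := by
      rw [← Real.rpow_add_one (abs_pos.2 ht).ne']; simp
    have h3 : (SignType.sign t : ℝ) * t = |t| := by
      rcases lt_or_gt_of_ne ht with h | h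
      · simp [h, abs_of_neg h]
      · simp [h, abs_of_pos h]
    simp only [id, mul_one]
    rw [h2]
    linear_combination (p * |t| ^ (p - 1)) * h3

lemma integrable_abs_rpow {v : ℝ → ℝ} (hv : MemLp v 2 volume) {R : ℝ} (hR : ∀ x, |v x| ≤ R) {q : ℝ}
    (hq : 2 ≤ q) : Integrable fun x => |v x| ^ q := by
  have h1 : Integrable fun x => R ^ (q - 2) * v x ^ 2 := hv.integrable_sq.const_mul _
  have hm : AEStronglyMeasurable (fun x => |v x| ^ q) volume :=
    (Real.continuous_rpow_const (by linarith)).comp_aestronglyMeasurable hv.1.norm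
  refine h1.mono' hm (Filter.Eventually.of_forall fun x => ?_)
  rw [Real.norm_of_nonneg (by positivity), ← sq_abs (v x)]
  have h2 : |v x| ^ q = |v x| ^ (q - 2) * |v x| ^ 2 := by
    rcases eq_or_lt_of_le hq with h | h
    · subst h; simp
    · rw [← Real.rpow_natCast, ← Real.rpow_add' (abs_nonneg _) (by push_cast; linarith)]
      congr 1; push_cast; ring
  rw [h2]
  exact mul_le_mul_of_nonneg_right
    (Real.rpow_le_rpow (abs_nonneg _) (hR x) (by linarith)) (by positivity)

lemma integral_abs_rpow_le {v v' v'' : ℝ → ℝ} (hv : ∀ x, HasDerivAt v (v' x) x)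
    (hv' : ∀ x, HasDerivAt v' (v'' x) x) (h0 : MemLp v 2 volume) (h1 : MemLp v' 2 volume)
    (h2 : MemLp v'' 2 volume) {R : ℝ} (hR : ∀ x, |v' x| ≤ R) {p : ℝ} (hp : 0 < p) :
    Integrable (fun x => |v x| * |v' x| ^ p * |v'' x|) ∧
    ∫ x, |v' x| ^ (p + 2) ≤ (p + 1) * ∫ x, |v x| * |v' x| ^ p * |v'' x| := by
  have hR0 : 0 ≤ R := (abs_nonneg _).trans (hR 0)
  have hm' : AEStronglyMeasurable (fun x => |v' x| ^ p) volume :=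
    (Real.continuous_rpow_const hp.le).comp_aestronglyMeasurable h1.1.norm
  have hb : ∀ x, ‖|v' x| ^ p‖ ≤ R ^ p := fun x => by
    rw [Real.norm_of_nonneg (by positivity)]
    exact Real.rpow_le_rpow (abs_nonneg _) (hR x) hp.le
  have hi : Integrable (fun x => |v x| * |v' x| ^ p * |v'' x|) := by
    have : Integrable fun x => (|v x| * |v'' x|) * |v' x| ^ p :=
      (h0.norm.integrable_mul h2.norm).mul_bdd (c := R ^ p) hm' (Filter.Eventually.of_forall hb)
    exact this.congr (Filter.Eventually.of_forall fun x => by simp only; ring)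
  refine ⟨hi, ?_⟩
  have hd : ∀ x, HasDerivAt (fun x => |v' x| ^ p * v' x) ((p + 1) * |v' x| ^ p * v'' x) x := fun x =>
    (hasDerivAt_abs_rpow_mul_self hp (v' x)).comp x (hv' x)
  have i1 : Integrable (v * fun x => (p + 1) * |v' x| ^ p * v'' x) := by
    have : Integrable fun x => (v x * v'' x) * |v' x| ^ p :=
      (h0.integrable_mul h2).mul_bdd (c := R ^ p) hm' (Filter.Eventually.of_forall hb)
    exact (this.const_mul (p + 1)).congr (Filter.Eventually.of_forall fun x => by
      simp only [Pi.mul_apply]; ring)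
  have i2 : Integrable (v' * fun x => |v' x| ^ p * v' x) := by
    have : Integrable fun x => (v' x * v' x) * |v' x| ^ p :=
      (h1.integrable_mul h1).mul_bdd (c := R ^ p) hm' (Filter.Eventually.of_forall hb)
    exact this.congr (Filter.Eventually.of_forall fun x => by simp only [Pi.mul_apply]; ring)
  have i3 : Integrable (v * fun x => |v' x| ^ p * v' x) := by
    have : Integrable fun x => (v x * v' x) * |v' x| ^ p :=
      (h0.integrable_mul h1).mul_bdd (c := R ^ p) hm' (Filter.Eventually.of_forall hb)
    exact this.congr (Filter.Eventually.of_forall fun x => by simp only [Pi.mul_apply]; ring)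
  have key := integral_mul_deriv_eq_deriv_mul_of_integrable (fun x _ => hv x) (fun x _ => hd x)
    i1 i2 i3
  have e1 : ∫ x, |v' x| ^ (p + 2) = ∫ x, v' x * (|v' x| ^ p * v' x) := by
    refine integral_congr_ae (Filter.Eventually.of_forall fun x => ?_)
    simp only
    rw [Real.rpow_add' (abs_nonneg _) (by positivity), Real.rpow_two, sq_abs]
    ring
  rw [e1, ← neg_eq_iff_eq_neg.2 key, ← integral_const_mul, ← integral_neg]
  refine integral_mono i1.neg (hi.const_mul _) fun x => ?_
  calc -(v x * ((p + 1) * |v' x| ^ p * v'' x)) ≤ |v x * ((p + 1) * |v' x| ^ p * v'' x)| :=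
        neg_le_abs _
    _ = (p + 1) * (|v x| * |v' x| ^ p * |v'' x|) := by
        rw [abs_mul, abs_mul, abs_mul, abs_of_pos (by linarith : 0 < p + 1),
          abs_of_nonneg (by positivity : 0 ≤ |v' x| ^ p)]
        ring

/-- Young's inequality with a small parameter. -/
lemma exists_young {w₁ w₂ w₃ : ℝ} (h₁ : 0 ≤ w₁) (h₂ : 0 ≤ w₂) (h₃ : 0 < w₃)
    (hw : w₁ + w₂ + w₃ = 1) {c ε : ℝ} (hc : 0 ≤ c) (hε : 0 < ε) :
    ∃ K : ℝ, 0 ≤ K ∧ ∀ A B D : ℝ, 0 ≤ A → 0 ≤ B → 0 ≤ D →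
      c * (A ^ w₁ * B ^ w₂ * D ^ w₃) ≤ ε * (A + B) + K * D := by
  set K := (c * ε ^ (-(w₁ + w₂))) ^ (1 / w₃) with hK
  have hK0 : 0 ≤ K := by positivity
  refine ⟨K, hK0, fun A B D hA hB hD => ?_⟩
  have h := Real.geom_mean_le_arith_mean3_weighted h₁ h₂ h₃.le (mul_nonneg hε.le hA)
    (mul_nonneg hε.le hB) (mul_nonneg hK0 hD) hw
  have hKw : K ^ w₃ = c * ε ^ (-(w₁ + w₂)) := by
    rw [hK, ← Real.rpow_mul (by positivity), one_div, inv_mul_cancel₀ h₃.ne', Real.rpow_one]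
  rw [Real.mul_rpow hε.le hA, Real.mul_rpow hε.le hB, Real.mul_rpow hK0 hD, hKw] at h
  have hone : ε ^ w₁ * ε ^ w₂ * ε ^ (-(w₁ + w₂)) = 1 := by
    rw [← Real.rpow_add hε, ← Real.rpow_add hε]; simp
  have e : ε ^ w₁ * A ^ w₁ * (ε ^ w₂ * B ^ w₂) * (c * ε ^ (-(w₁ + w₂)) * D ^ w₃) =
      c * (A ^ w₁ * B ^ w₂ * D ^ w₃) := by
    linear_combination (c * (A ^ w₁ * B ^ w₂ * D ^ w₃)) * hone
  rw [e] at h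
  refine h.trans ?_
  have : w₁ ≤ 1 := by linarith
  have : w₂ ≤ 1 := by linarith
  have : w₃ ≤ 1 := by linarith
  have a1 : w₁ * (ε * A) ≤ ε * A := mul_le_of_le_one_left (by positivity) (by linarith)
  have a2 : w₂ * (ε * B) ≤ ε * B := mul_le_of_le_one_left (by positivity) (by linarith)
  have a3 : w₃ * (K * D) ≤ K * D := mul_le_of_le_one_left (by positivity) (by linarith)
  linarith

/-- `u` is `C^n` with derivatives up to order `n` square integrable and bounded by `R`. -/
structure IsRegular (n : ℕ) (R : ℝ) (u : ℝ → ℝ) : Prop where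
  contDiff : ContDiff ℝ n u
  bound : ∀ j ≤ n, ∀ x, |iteratedDeriv j u x| ≤ R
  memLp : ∀ j ≤ n, MemLp (iteratedDeriv j u) 2 volume

namespace IsRegular

variable {n : ℕ} {R : ℝ} {u : ℝ → ℝ}

lemma hasDerivAt (h : IsRegular n R u) {j : ℕ} (hj : j < n) (x : ℝ) :
    HasDerivAt (iteratedDeriv j u) (iteratedDeriv (j + 1) u x) x := by
  rw [iteratedDeriv_succ]
  exact (h.contDiff.differentiable_iteratedDeriv j (by exact_mod_cast hj) x).hasDerivAt

lemma two_le_div {j : ℕ} (hj : 1 ≤ j) (hjn : j ≤ n) : (2 : ℝ) ≤ 2 * n / j := by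
  have h1 : (0 : ℝ) < j := by exact_mod_cast hj
  have h2 : (j : ℝ) ≤ n := by exact_mod_cast hjn
  rw [le_div_iff₀ h1]
  linarith

lemma integrable_rpow (h : IsRegular n R u) {j : ℕ} (hj : 1 ≤ j) (hjn : j ≤ n) :
    Integrable fun x => |iteratedDeriv j u x| ^ (2 * n / j : ℝ) :=
  integrable_abs_rpow (h.memLp j hjn) (h.bound j hjn) (two_le_div hj hjn)

/-- One integration by parts. -/
lemma integral_rpow_le (h : IsRegular n R u) {j : ℕ} (hj : 1 ≤ j) (hjn : j < n) :
    Integrable (fun x => |iteratedDeriv (j - 1) u x| * |iteratedDeriv j u x| ^ (2 * n / j - 2 : ℝ) *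
      |iteratedDeriv (j + 1) u x|) ∧
    ∫ x, |iteratedDeriv j u x| ^ (2 * n / j : ℝ) ≤
      (2 * n / j - 1) * ∫ x, |iteratedDeriv (j - 1) u x| *
        |iteratedDeriv j u x| ^ (2 * n / j - 2 : ℝ) * |iteratedDeriv (j + 1) u x| := by
  have hp : (0 : ℝ) < 2 * n / j - 2 := by
    have h1 : (0 : ℝ) < j := by exact_mod_cast hj
    have h2 : (j : ℝ) < n := by exact_mod_cast hjn
    rw [sub_pos, lt_div_iff₀ h1]
    linarith
  have hd : ∀ x, HasDerivAt (iteratedDeriv (j - 1) u) (iteratedDeriv j u x) x := fun x => by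
    have := h.hasDerivAt (j := j - 1) (by omega) x
    rwa [Nat.sub_add_cancel hj] at this
  have := integral_abs_rpow_le hd (h.hasDerivAt hjn) (h.memLp _ (by omega)) (h.memLp _ hjn.le)
    (h.memLp _ hjn) (h.bound j hjn.le) hp
  refine ⟨this.1, ?_⟩
  have h2 := this.2
  rw [sub_add_cancel] at h2
  convert h2 using 2
  ring

end IsRegular

lemma exists_gagliardo_nirenberg_step {n : ℕ} {M : ℝ} (hM : 0 ≤ M) (j : ℕ) (hj : 1 ≤ j) (hjn : j < n) :
    ∃ C : ℝ, 0 ≤ C ∧ ∀ u R, IsRegular n R u → (∀ x, |u x| ≤ M) →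
      ∫ x, |iteratedDeriv j u x| ^ (2 * n / j : ℝ) ≤
        C * ∫ x, |iteratedDeriv (j + 1) u x| ^ (2 * n / (j + 1 : ℕ) : ℝ) := by
  induction j, hj using Nat.le_induction with
  | base =>
    have hn : (1 : ℝ) < n := by exact_mod_cast hjn
    obtain ⟨K, hK0, hK⟩ := exists_young (w₁ := 0) (w₂ := 1 - 1 / n) (w₃ := 1 / n) le_rfl
      (by rw [sub_nonneg, div_le_one (by linarith)]; exact hn.le) (by positivity) (by ring)
      (c := (2 * n - 1) * M) (ε := 1 / 2) (mul_nonneg (by linarith) hM) (by norm_num)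
    refine ⟨2 * K, by positivity, fun u R h hu => ?_⟩
    have h1 := h.integral_rpow_le le_rfl hjn
    simp only [Nat.sub_self, iteratedDeriv_zero, Nat.cast_one, div_one] at h1
    have hB := h.integrable_rpow le_rfl hjn.le
    simp only [Nat.cast_one, div_one] at hB ⊢
    have hD := h.integrable_rpow (j := 2) (by norm_num) hjn
    set B := fun x => |iteratedDeriv 1 u x| ^ (2 * n : ℝ) with hBdef
    set D := fun x => |iteratedDeriv (1 + 1) u x| ^ (2 * n / (1 + 1 : ℕ) : ℝ) with hDdef
    have hD : Integrable D := hD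
    have hpt : ∀ x, (2 * n - 1) * (|u x| * |iteratedDeriv 1 u x| ^ (2 * n - 2 : ℝ) *
        |iteratedDeriv (1 + 1) u x|) ≤ 1 / 2 * B x + K * D x := by
      intro x
      have := hK 0 (B x) (D x) le_rfl (by positivity) (by positivity)
      rw [Real.rpow_zero, one_mul, zero_add] at this
      refine le_trans ?_ this
      have e1 : B x ^ (1 - 1 / n : ℝ) = |iteratedDeriv 1 u x| ^ (2 * n - 2 : ℝ) := by
        rw [hBdef]; simp only
        rw [← Real.rpow_mul (abs_nonneg _)]
        congr 1
        field_simp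
      have e2 : D x ^ (1 / n : ℝ) = |iteratedDeriv (1 + 1) u x| := by
        rw [hDdef]; simp only
        rw [← Real.rpow_mul (abs_nonneg _)]
        convert Real.rpow_one _ using 2
        push_cast
        field_simp
      rw [e1, e2]
      have : 0 ≤ (2 * n - 1 : ℝ) := by linarith
      calc _ ≤ (2 * n - 1) * (M * |iteratedDeriv 1 u x| ^ (2 * n - 2 : ℝ) *
            |iteratedDeriv (1 + 1) u x|) := by
              gcongr
              exact hu x
        _ = _ := by ring
    have h2 := integral_mono (h1.1.const_mul (2 * n - 1 : ℝ))
      ((hB.const_mul (1 / 2)).add (hD.const_mul K)) hpt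
    rw [integral_const_mul] at h2
    have h3 : ∫ x, ((fun x => 1 / 2 * B x) + fun x => K * D x) x = 1 / 2 * (∫ x, B x) + K * ∫ x, D x := by
      rw [integral_add' (hB.const_mul (1 / 2)) (hD.const_mul K), integral_const_mul,
        integral_const_mul]
    rw [h3] at h2
    have h4 := h1.2.trans h2
    change ∫ x, B x ≤ _ at h4
    linarith
  | succ j hj ih =>
    obtain ⟨C, hC0, hC⟩ := ih (by omega)
    have hj0 : (0 : ℝ) < j := by exact_mod_cast hj
    have hn : ((j : ℝ) + 1) < n := by exact_mod_cast hjn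
    have hn0 : (0 : ℝ) < n := by linarith
    set q : ℝ := 2 * n / (j + 1 : ℕ) with hq
    have hq2 : 2 ≤ q := IsRegular.two_le_div (by omega) hjn.le
    obtain ⟨K, hK0, hK⟩ := exists_young (w₁ := j / (2 * n)) (w₂ := 1 - (j + 1) / n)
      (w₃ := (j + 2) / (2 * n)) (by positivity)
      (by rw [sub_nonneg, div_le_one (by linarith)]; exact hn.le) (by positivity)
      (by field_simp; ring)
      (c := q - 1) (ε := 1 / (2 * (C + 1))) (by linarith) (by positivity)
    refine ⟨2 * K, by positivity, fun u R h hu => ?_⟩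
    have h1 := h.integral_rpow_le (j := j + 1) (by omega) hjn
    have hA := h.integrable_rpow hj (by omega)
    have hB := h.integrable_rpow (j := j + 1) (by omega) hjn.le
    have hD := h.integrable_rpow (j := j + 1 + 1) (by omega) hjn
    have hAB := hC u R h hu
    rw [← hq] at h1 hB
    rw [Nat.add_sub_cancel] at h1
    set A := fun x => |iteratedDeriv j u x| ^ (2 * n / j : ℝ) with hAdef
    set B := fun x => |iteratedDeriv (j + 1) u x| ^ q with hBdef
    set D := fun x => |iteratedDeriv (j + 1 + 1) u x| ^ (2 * n / (j + 1 + 1 : ℕ) : ℝ) with hDdef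
    have hpt : ∀ x, (q - 1) * (|iteratedDeriv j u x| * |iteratedDeriv (j + 1) u x| ^ (q - 2) *
        |iteratedDeriv (j + 1 + 1) u x|) ≤ 1 / (2 * (C + 1)) * (A x + B x) + K * D x := by
      intro x
      have := hK (A x) (B x) (D x) (by positivity) (by positivity) (by positivity)
      refine le_trans (le_of_eq ?_) this
      have e0 : A x ^ (j / (2 * n) : ℝ) = |iteratedDeriv j u x| := by
        rw [hAdef]; simp only
        rw [← Real.rpow_mul (abs_nonneg _)]
        convert Real.rpow_one _ using 2
        field_simp
      have e1 : B x ^ (1 - (j + 1) / n : ℝ) = |iteratedDeriv (j + 1) u x| ^ (q - 2) := by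
        rw [hBdef]; simp only
        rw [← Real.rpow_mul (abs_nonneg _), hq]
        congr 1
        push_cast
        field_simp
      have e2 : D x ^ ((j + 2) / (2 * n) : ℝ) = |iteratedDeriv (j + 1 + 1) u x| := by
        rw [hDdef]; simp only
        rw [← Real.rpow_mul (abs_nonneg _)]
        convert Real.rpow_one _ using 2
        push_cast
        field_simp
        ring
      rw [e0, e1, e2]
    have h2 := integral_mono (h1.1.const_mul (q - 1))
      (((hA.add hB).const_mul (1 / (2 * (C + 1)))).add (hD.const_mul K)) hpt
    rw [integral_const_mul] at h2
    have h3 : ∫ x, ((fun x => 1 / (2 * (C + 1)) * (A + B) x) + fun x => K * D x) x =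
        1 / (2 * (C + 1)) * ((∫ x, A x) + ∫ x, B x) + K * ∫ x, D x := by
      rw [integral_add' ((hA.add hB).const_mul _) (hD.const_mul K), integral_const_mul,
        integral_const_mul, integral_add' hA hB]
    rw [h3] at h2
    have h4 := h1.2.trans h2
    change ∫ x, B x ≤ _ at h4
    change ∫ x, A x ≤ C * ∫ x, B x at hAB
    have h5 : 1 / (2 * (C + 1)) * ((∫ x, A x) + ∫ x, B x) ≤ 1 / 2 * ∫ x, B x := by
      rw [one_div, inv_mul_le_iff₀ (by positivity)]
      linarith
    linarith

/-- The Gagliardo–Nirenberg inequality for intermediate derivatives of a bounded function. -/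
lemma exists_gagliardo_nirenberg (n : ℕ) {M : ℝ} (hM : 0 ≤ M) (j : ℕ) (hj : 1 ≤ j) (hjn : j ≤ n) :
    ∃ C : ℝ, 0 ≤ C ∧ ∀ u R, IsRegular n R u → (∀ x, |u x| ≤ M) →
      ∫ x, |iteratedDeriv j u x| ^ (2 * n / j : ℝ) ≤ C * ∫ x, iteratedDeriv n u x ^ 2 := by
  induction hk : n - j generalizing j with
  | zero =>
    obtain rfl : j = n := by omega
    refine ⟨1, zero_le_one, fun u R _ _ => le_of_eq ?_⟩
    rw [one_mul, mul_div_assoc, div_self (by positivity), mul_one]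
    simp
  | succ k ih =>
    obtain ⟨C, hC0, hC⟩ := exists_gagliardo_nirenberg_step (n := n) hM j hj (by omega)
    obtain ⟨C', hC'0, hC'⟩ := ih (j + 1) (by omega) (by omega) (by omega)
    refine ⟨C * C', by positivity, fun u R h hu => (hC u R h hu).trans ?_⟩
    rw [mul_assoc]
    exact mul_le_mul_of_nonneg_left (hC' u R h hu) hC0

/-! ### The nonlinearity -/

lemma forall_abs_le_of_ae {w : ℝ → ℝ} (hw : Continuous w) {M : ℝ} (h : ∀ᵐ x, |w x| ≤ M) (x : ℝ) :
    |w x| ≤ M := by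
  have hc : IsClosed {x | |w x| ≤ M} := isClosed_le hw.abs continuous_const
  have hd : Dense {x | |w x| ≤ M} := Measure.dense_of_ae h
  have : x ∈ closure {x | |w x| ≤ M} := hd x
  rwa [hc.closure_eq] at this

lemma Hs.coeFn_sub {s : ℝ} (u v : Hs s) : (u - v : Hs s) =ᵐ[volume] fun x => u x - v x :=
  Lp.coeFn_sub (Hs.toL2 u) (Hs.toL2 v)

lemma eLpNorm_two_eq {g : ℝ → ℝ} (hg : MemLp g 2 volume) :
    eLpNorm g 2 volume = ENNReal.ofReal (√(∫ x, g x ^ 2)) := by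
  rw [hg.eLpNorm_eq_integral_rpow_norm (by norm_num) (by norm_num), Real.sqrt_eq_rpow]
  simp

/-- `L²` bounds for the derivatives of `f ∘ u - f ∘ v`. -/
lemma exists_eLpNorm_comp_sub_le {n : ℕ} {f : ℝ → ℝ} (hf : ContDiff ℝ (n + 1 : ℕ) f) {R : ℝ}
    (hR : 0 ≤ R) :
    ∃ L : ℝ, 0 ≤ L ∧ ∀ u v : ℝ → ℝ, ContDiff ℝ n u → ContDiff ℝ n v →
      (∀ j ≤ n, ∀ x, |iteratedDeriv j u x| ≤ R) → (∀ j ≤ n, ∀ x, |iteratedDeriv j v x| ≤ R) →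
      ∀ E : ℝ, 0 ≤ E → (∀ j ≤ n, eLpNorm (iteratedDeriv j (u - v)) 2 volume ≤ ENNReal.ofReal E) →
      ∀ j ≤ n, eLpNorm (iteratedDeriv j (fun y => f (u y) - f (v y))) 2 volume ≤
        ENNReal.ofReal (L * E) := by
  have hfj : ∀ j ≤ n, ContDiff ℝ (j + 1 : ℕ) f := fun j hj =>
    hf.of_le (by exact_mod_cast Nat.succ_le_succ hj)
  choose! L hL0 hL using fun j (hj : j ≤ n) =>
    exists_iteratedDeriv_comp_sub_le j f (hfj j hj) R hR
  have hmem : ∀ j ∈ Finset.range (n + 1), 0 ≤ L j * (n + 1) := fun j hj =>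
    mul_nonneg (hL0 j (Nat.lt_succ_iff.1 (Finset.mem_range.1 hj))) (by positivity)
  refine ⟨∑ j ∈ Finset.range (n + 1), L j * (n + 1), Finset.sum_nonneg hmem, ?_⟩
  intro u v hu hv hub hvb E hE hd j hj
  have hle : ∀ i ≤ n, (i : WithTop ℕ∞) ≤ (n : WithTop ℕ∞) := fun i hi => by exact_mod_cast hi
  have hfn : ContDiff ℝ n f := hf.of_le (by exact_mod_cast Nat.le_succ n)
  have hpt : ∀ x, ‖iteratedDeriv j (fun y => f (u y) - f (v y)) x‖ ≤
      L j * ‖∑ i ∈ Finset.range (j + 1), ‖iteratedDeriv i (u - v) x‖‖ := by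
    intro x
    have e1 : iteratedDeriv j (fun y => f (u y) - f (v y)) x =
        iteratedDeriv j (fun y => f (u y)) x - iteratedDeriv j (fun y => f (v y)) x :=
      iteratedDeriv_fun_sub ((hfn.comp hu).of_le (hle j hj)).contDiffAt
        ((hfn.comp hv).of_le (hle j hj)).contDiffAt
    have e2 : ∀ i ∈ Finset.range (j + 1), ‖iteratedDeriv i (u - v) x‖ =
        |iteratedDeriv i u x - iteratedDeriv i v x| := fun i hi => by
      have hi' : i ≤ n := (Nat.lt_succ_iff.1 (Finset.mem_range.1 hi)).trans hj
      rw [iteratedDeriv_sub (hu.of_le (hle i hi')).contDiffAt (hv.of_le (hle i hi')).contDiffAt,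
        Real.norm_eq_abs]
    rw [e1, Finset.sum_congr rfl e2, Real.norm_of_nonneg (Finset.sum_nonneg fun _ _ => abs_nonneg _)]
    exact hL j hj u v (hu.of_le (hle j hj)) (hv.of_le (hle j hj)) x
      (fun i hi => hub i (hi.trans hj) x) (fun i hi => hvb i (hi.trans hj) x)
  refine (eLpNorm_le_mul_eLpNorm_of_ae_le_mul (Filter.Eventually.of_forall hpt) 2).trans ?_
  have hm : ∀ i ∈ Finset.range (j + 1),
      AEStronglyMeasurable (fun x => ‖iteratedDeriv i (u - v) x‖) volume := fun i hi => by
    have hi' : i ≤ n := (Nat.lt_succ_iff.1 (Finset.mem_range.1 hi)).trans hj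
    exact ((hu.sub hv).continuous_iteratedDeriv i (hle i hi')).norm.aestronglyMeasurable
  have h2 := eLpNorm_sum_le (p := 2) hm (by norm_num)
  have h3 : eLpNorm (fun x => ∑ i ∈ Finset.range (j + 1), ‖iteratedDeriv i (u - v) x‖) 2 volume ≤
      ENNReal.ofReal ((n + 1) * E) := by
    have e : (fun x => ∑ i ∈ Finset.range (j + 1), ‖iteratedDeriv i (u - v) x‖) =
        ∑ i ∈ Finset.range (j + 1), fun x => ‖iteratedDeriv i (u - v) x‖ := by
      funext x; simp
    rw [e]
    refine h2.trans ((Finset.sum_le_card_nsmul _ _ (ENNReal.ofReal E) fun i hi => ?_).trans ?_)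
    · rw [eLpNorm_norm]
      exact hd i ((Nat.lt_succ_iff.1 (Finset.mem_range.1 hi)).trans hj)
    · rw [Finset.card_range, nsmul_eq_mul, ENNReal.ofReal_mul (by positivity)]
      gcongr
      rw [← ENNReal.ofReal_natCast]
      refine ENNReal.ofReal_le_ofReal ?_
      push_cast
      have : (j : ℝ) ≤ n := by exact_mod_cast hj
      linarith
  refine (mul_le_mul_right h3 _).trans ?_
  rw [← ENNReal.ofReal_mul (hL0 j hj), ← mul_assoc]
  refine ENNReal.ofReal_le_ofReal (mul_le_mul_of_nonneg_right ?_ hE)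
  exact Finset.single_le_sum (f := fun j => L j * ((n : ℝ) + 1)) hmem
    (Finset.mem_range.2 (Nat.lt_succ_of_le hj))

section Nonlinearity

variable {s : ℝ} {n : ℕ} {f : ℝ → ℝ}

lemma Hs.memLp_comp_and_lipschitz (hs : n + 1 / 2 < s) (hf : ContDiff ℝ (n + 1 : ℕ) f)
    (hf0 : f 0 = 0) :
    (∀ u : Hs s, MemLp (fun x => f (u x)) 2 volume) ∧
    ∀ R : ℝ, 0 ≤ R → ∃ L : ℝ, 0 ≤ L ∧ ∀ u v : Hs s, ‖u‖ ≤ R → ‖v‖ ≤ R →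
      ∀ d : Lp ℝ 2 (volume : Measure ℝ), (d =ᵐ[volume] fun x => f (u x) - f (v x)) →
        eLpNorm (weightedFourier n d) 2 volume ≤ ENNReal.ofReal (L * ‖u - v‖) := by
  obtain ⟨C, hC0, hC⟩ := Hs.exists_rep hs
  choose rep hrep hreps hrepb using hC
  have hsub : ∀ u v : Hs s, rep u - rep v = rep (u - v) := by
    intro u v
    rw [← Continuous.ae_eq_iff_eq (volume : Measure ℝ) ((hreps u).continuous.sub
      (hreps v).continuous) (hreps _).continuous]
    filter_upwards [hrep u, hrep v, hrep (u - v), Hs.coeFn_sub u v] with x h1 h2 h3 h4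
    rw [Pi.sub_apply, ← h1, ← h2, ← h3, h4]
  have hfn : ContDiff ℝ n f := hf.of_le (by exact_mod_cast Nat.le_succ n)
  have key : ∀ R : ℝ, 0 ≤ R → ∃ L : ℝ, 0 ≤ L ∧ ∀ u v : Hs s, ‖u‖ ≤ R → ‖v‖ ≤ R → ∀ j ≤ n,
      eLpNorm (iteratedDeriv j (fun y => f (rep u y) - f (rep v y))) 2 volume ≤
        ENNReal.ofReal (L * ‖u - v‖) := by
    intro R hR
    obtain ⟨L, hL0, hL⟩ := exists_eLpNorm_comp_sub_le hf (R := C * R) (by positivity)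
    refine ⟨L, hL0, fun u v hu hv => ?_⟩
    refine hL _ _ (hreps u) (hreps v) (fun j hj x => ?_) (fun j hj x => ?_) _ (norm_nonneg _)
      (fun j hj => ?_)
    · exact ((hrepb u j hj).1 x).trans (by gcongr)
    · exact ((hrepb v j hj).1 x).trans (by gcongr)
    · rw [hsub]; exact (hrepb _ j hj).2.2
  refine ⟨fun u => ?_, fun R hR => ?_⟩
  · obtain ⟨L, _, hL⟩ := key ‖u‖ (norm_nonneg u)
    have h1 := hL u 0 le_rfl (by simp) 0 (Nat.zero_le _)
    have h0 : rep 0 = 0 := by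
      have := hsub u u
      rwa [sub_self, sub_self, eq_comm] at this
    simp only [iteratedDeriv_zero, h0, Pi.zero_apply, hf0, sub_zero] at h1
    have h2 : MemLp (fun y => f (rep u y)) 2 volume :=
      ⟨(hf.continuous.comp (hreps u).continuous).aestronglyMeasurable,
        h1.trans_lt ENNReal.ofReal_lt_top⟩
    refine (memLp_congr_ae ?_).1 h2
    filter_upwards [hrep u] with x hx
    rw [hx]
  · obtain ⟨L, hL0, hL⟩ := key R hR
    refine ⟨2 ^ n * (L + L), by positivity, fun u v hu hv d hd => ?_⟩
    have hW : ContDiff ℝ n (fun y => f (rep u y) - f (rep v y)) :=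
      (hfn.comp (hreps u)).sub (hfn.comp (hreps v))
    have hLm : ∀ j ≤ n, MemLp (iteratedDeriv j (fun y => f (rep u y) - f (rep v y))) 2 volume :=
      fun j hj => ⟨(hW.continuous_iteratedDeriv j (by exact_mod_cast hj)).aestronglyMeasurable,
        (hL u v hu hv j hj).trans_lt ENNReal.ofReal_lt_top⟩
    have hdW : d =ᵐ[volume] fun y => f (rep u y) - f (rep v y) := by
      filter_upwards [hd, hrep u, hrep v] with x h1 h2 h3
      rw [h1, h2, h3]
    refine (eLpNorm_weightedFourier_le hW hLm hdW).trans ?_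
    have h0 := hL u v hu hv 0 (Nat.zero_le _)
    rw [iteratedDeriv_zero] at h0
    refine (mul_le_mul_right (add_le_add h0 (hL u v hu hv n le_rfl)) _).trans (le_of_eq ?_)
    rw [← ENNReal.ofReal_add (by positivity) (by positivity), ← ENNReal.ofReal_ofNat 2,
      ← ENNReal.ofReal_pow (by norm_num), ← ENNReal.ofReal_mul (by positivity)]
    congr 1; ring

/-- The Moser estimate: `‖f(u)‖_{H^n} ≤ C(‖u‖_∞) ‖u‖_{H^s}`. -/
lemma Hs.exists_moser (hs : n + 1 / 2 < s) (hf : ContDiff ℝ (n + 1 : ℕ) f) (hf0 : f 0 = 0)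
    {M : ℝ} (hM : 0 ≤ M) :
    ∃ L : ℝ, 0 ≤ L ∧ ∀ u : Hs s, (∀ᵐ x, |u x| ≤ M) →
      ∀ d : Lp ℝ 2 (volume : Measure ℝ), (d =ᵐ[volume] fun x => f (u x)) →
        eLpNorm (weightedFourier n d) 2 volume ≤ ENNReal.ofReal (L * ‖u‖) := by
  obtain ⟨C, hC0, hC⟩ := Hs.exists_rep hs
  have hfn : ContDiff ℝ n f := hf.of_le (by exact_mod_cast Nat.le_succ n)
  obtain ⟨L₀, hL₀0, hL₀⟩ := exists_lipschitz_bound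
    (hf.of_le (by exact_mod_cast Nat.succ_le_succ (Nat.zero_le n)) : ContDiff ℝ 1 f) M
  have hlow : ∀ w : ℝ → ℝ, (∀ x, |w x| ≤ M) → ∀ E : ℝ, eLpNorm w 2 volume ≤ ENNReal.ofReal E →
      eLpNorm (fun y => f (w y)) 2 volume ≤ ENNReal.ofReal (L₀ * E) := by
    intro w hw E hE
    have hpt : ∀ x, ‖f (w x)‖ ≤ L₀ * ‖w x‖ := fun x => by
      simpa [hf0] using hL₀ (w x) 0 (hw x) (by simpa using hM)
    refine (eLpNorm_le_mul_eLpNorm_of_ae_le_mul (Filter.Eventually.of_forall hpt) 2).trans ?_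
    rw [ENNReal.ofReal_mul hL₀0]
    gcongr
  have hhigh : ∃ L₁ : ℝ, 0 ≤ L₁ ∧ ∀ w R, IsRegular n R w → (∀ x, |w x| ≤ M) → ∀ E : ℝ, 0 ≤ E →
      (∀ j ≤ n, eLpNorm (iteratedDeriv j w) 2 volume ≤ ENNReal.ofReal E) →
      eLpNorm (iteratedDeriv n fun y => f (w y)) 2 volume ≤ ENNReal.ofReal (L₁ * E) := by
    rcases Nat.eq_zero_or_pos n with hn | hn
    · subst hn
      refine ⟨L₀, hL₀0, fun w R _ hw E hE hj => ?_⟩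
      simpa using hlow w hw E (by simpa using hj 0 le_rfl)
    obtain ⟨A, hA0, hA⟩ := exists_iteratedDeriv_comp_le hn hfn M
    choose! G hG0 hG using fun j (hj : 1 ≤ j) (hjn : j ≤ n) =>
      exists_gagliardo_nirenberg n hM j hj hjn
    refine ⟨A * ∑ j ∈ Finset.Icc 1 n, √(G j), by positivity, fun w R hw hwM E hE hj => ?_⟩
    have hpt : ∀ x, ‖iteratedDeriv n (fun y => f (w y)) x‖ ≤
        A * ‖∑ j ∈ Finset.Icc 1 n, |iteratedDeriv j w x| ^ ((n : ℝ) / j)‖ := fun x => by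
      rw [Real.norm_of_nonneg (Finset.sum_nonneg fun j _ => by positivity)]
      exact hA w hw.contDiff x (hwM x)
    refine (eLpNorm_le_mul_eLpNorm_of_ae_le_mul (Filter.Eventually.of_forall hpt) 2).trans ?_
    rw [mul_assoc, ENNReal.ofReal_mul hA0]
    gcongr
    have e : (fun x => ∑ j ∈ Finset.Icc 1 n, |iteratedDeriv j w x| ^ ((n : ℝ) / j)) =
        ∑ j ∈ Finset.Icc 1 n, fun x => |iteratedDeriv j w x| ^ ((n : ℝ) / j) := by
      funext x; simp
    have hm : ∀ j ∈ Finset.Icc 1 n,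
        AEStronglyMeasurable (fun x => |iteratedDeriv j w x| ^ ((n : ℝ) / j)) volume := fun j hj => by
      have := (hw.contDiff.continuous_iteratedDeriv j
        (by exact_mod_cast (Finset.mem_Icc.1 hj).2)).abs
      exact (this.rpow_const fun _ => Or.inr (by positivity)).aestronglyMeasurable
    rw [e, Finset.sum_mul, ENNReal.ofReal_sum_of_nonneg fun j _ => by positivity]
    refine (eLpNorm_sum_le hm (by norm_num)).trans (Finset.sum_le_sum fun j hj' => ?_)
    obtain ⟨h1, h2⟩ := Finset.mem_Icc.1 hj'
    have hsq : ∀ x, (|iteratedDeriv j w x| ^ ((n : ℝ) / j)) ^ 2 =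
        |iteratedDeriv j w x| ^ (2 * n / j : ℝ) := fun x => by
      rw [← Real.rpow_mul_natCast (abs_nonneg _)]
      congr 1; push_cast; ring
    have hmem : MemLp (fun x => |iteratedDeriv j w x| ^ ((n : ℝ) / j)) 2 volume := by
      rw [memLp_two_iff_integrable_sq (hm j hj')]
      simpa only [hsq] using hw.integrable_rpow h1 h2
    rw [eLpNorm_two_eq hmem]
    simp only [hsq]
    have hEn : √(∫ x, iteratedDeriv n w x ^ 2) ≤ E := by
      have := hj n le_rfl
      rwa [eLpNorm_two_eq (hw.memLp n le_rfl), ENNReal.ofReal_le_ofReal_iff hE] at this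
    refine ENNReal.ofReal_le_ofReal ?_
    calc √(∫ x, |iteratedDeriv j w x| ^ (2 * n / j : ℝ))
        ≤ √(G j * ∫ x, iteratedDeriv n w x ^ 2) := Real.sqrt_le_sqrt (hG j h1 h2 w R hw hwM)
      _ = √(G j) * √(∫ x, iteratedDeriv n w x ^ 2) := Real.sqrt_mul (hG0 j h1 h2) _
      _ ≤ √(G j) * E := by gcongr
  obtain ⟨L₁, hL₁0, hL₁⟩ := hhigh
  refine ⟨2 ^ n * (L₀ + L₁), by positivity, fun u hu d hd => ?_⟩
  obtain ⟨w, hwu, hwc, hwb⟩ := hC u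
  have hreg : IsRegular n (C * ‖u‖) w :=
    ⟨hwc, fun j hj => (hwb j hj).1, fun j hj => (hwb j hj).2.1⟩
  have hwM : ∀ x, |w x| ≤ M := forall_abs_le_of_ae hwc.continuous (by
    filter_upwards [hu, hwu] with x h1 h2
    rwa [← h2])
  have hdw : d =ᵐ[volume] fun y => f (w y) := by
    filter_upwards [hd, hwu] with x h1 h2
    rw [h1, h2]
  have hLm : ∀ j ≤ n, MemLp (iteratedDeriv j (fun y => f (w y))) 2 volume := by
    obtain ⟨L, _, hL⟩ := exists_eLpNorm_comp_sub_le hf (R := C * ‖u‖) (by positivity)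
    intro j hj
    have h0 : ∀ k x, iteratedDeriv k (fun _ : ℝ => (0 : ℝ)) x = 0 := fun k x => by simp
    have := hL w (fun _ => 0) hwc contDiff_const hreg.bound
      (fun k _ x => by rw [h0]; simp; positivity) ‖u‖ (norm_nonneg _) (fun k hk => by
        have e : (w - fun _ => (0 : ℝ)) = w := by funext x; simp
        rw [e]; exact (hwb k hk).2.2) j hj
    simp only [hf0, sub_zero] at this
    exact ⟨((hfn.comp hwc).continuous_iteratedDeriv j (by exact_mod_cast hj)).aestronglyMeasurable,
      this.trans_lt ENNReal.ofReal_lt_top⟩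
  refine (eLpNorm_weightedFourier_le (hfn.comp hwc) hLm hdw).trans ?_
  have h0 := hlow w hwM ‖u‖ (by simpa using (hwb 0 (Nat.zero_le _)).2.2)
  have h1 := hL₁ w _ hreg hwM ‖u‖ (norm_nonneg _) fun j hj => (hwb j hj).2.2
  refine (mul_le_mul_right (add_le_add h0 h1) _).trans (le_of_eq ?_)
  rw [← ENNReal.ofReal_add (by positivity) (by positivity), ← ENNReal.ofReal_ofNat 2,
    ← ENNReal.ofReal_pow (by norm_num), ← ENNReal.ofReal_mul (by positivity)]
  congr 1; ring

end Nonlinearity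

/-! ### Completeness of `H^s(ℝ)` -/

lemma weight_nonneg_le_one {a : ℝ} (ha : a ≤ 0) (ξ : ℝ) : weight a ξ ≤ 1 := by
  refine (weight_mono ha ξ).trans (le_of_eq ?_)
  simp [weight]

lemma isometry_fourierL2 : Isometry fourierL2 := by
  refine Isometry.of_dist_eq fun u v => ?_
  rw [dist_eq_norm, dist_eq_norm, ← fourierL2_sub, Lp.norm_def, Lp.norm_def, eLpNorm_fourierL2]

lemma Hs.isometry_toWeightedL2 (s : ℝ) : Isometry (Hs.toWeightedL2 s) := by
  refine Isometry.of_dist_eq fun u v => ?_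
  rw [dist_eq_norm, dist_eq_norm, ← map_sub]
  rfl

lemma Hs.completeSpace {s : ℝ} (hs : 0 ≤ s) : CompleteSpace (Hs s) := by
  rw [completeSpace_iff_isComplete_range (Hs.isometry_toWeightedL2 s).isUniformInducing]
  have hm : MemLp (fun ξ => (weight (-s) ξ : ℂ)) ∞ volume := by
    refine memLp_top_of_bound
      (Complex.continuous_ofReal.comp (continuous_weight (-s))).aestronglyMeasurable 1 ?_
    refine Filter.Eventually.of_forall fun ξ => ?_
    rw [Complex.norm_real, Real.norm_of_nonneg (weight_pos _ _).le]
    exact weight_nonneg_le_one (by linarith) ξ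
  let A : Lp ℂ 2 (volume : Measure ℝ) →L[ℂ] Lp ℂ 2 (volume : Measure ℝ) :=
    (ContinuousLinearMap.mul ℂ ℂ).holderL volume ∞ 2 2 (hm.toLp _)
  have hA : ∀ W, A W =ᵐ[volume] fun ξ => (weight (-s) ξ : ℂ) * W ξ := by
    intro W
    filter_upwards [(ContinuousLinearMap.mul ℂ ℂ).coeFn_holder (r := 2) (hm.toLp _) W,
      hm.coeFn_toLp] with ξ h1 h2
    change A W ξ = _ at h1
    rw [h1, h2]
    rfl
  have hw : ∀ ξ, (weight s ξ : ℂ) * (weight (-s) ξ : ℂ) = 1 := by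
    intro ξ
    rw [← Complex.ofReal_mul, ← weight_add, add_neg_cancel]
    simp [weight]
  have hr : range (Hs.toWeightedL2 s) = A ⁻¹' range fourierL2 := by
    ext W
    constructor
    · rintro ⟨u, rfl⟩
      refine ⟨Hs.toL2 u, Lp.ext ?_⟩
      filter_upwards [hA (Hs.toWeightedL2 s u), (Hs.memLp_weightedFourier u).coeFn_toLp]
        with ξ h1 h2
      rw [h1]
      change _ = _ * (MemLp.toLp _ (Hs.memLp_weightedFourier u)) ξ
      rw [h2, weightedFourier, ← mul_assoc, mul_comm (weight (-s) ξ : ℂ), hw, one_mul]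
    · rintro ⟨u, hu⟩
      have h1 : weightedFourier s u =ᵐ[volume] W := by
        filter_upwards [hA W] with ξ h1
        rw [weightedFourier, hu, h1, ← mul_assoc, hw, one_mul]
      have h2 : MemLp (weightedFourier s u) 2 volume := (memLp_congr_ae h1).2 (Lp.memLp W)
      exact ⟨⟨u, h2⟩, Lp.ext (h2.coeFn_toLp.trans h1)⟩
  rw [hr]
  exact (isometry_fourierL2.isClosedEmbedding.isClosed_range.preimage A.continuous).isComplete

/-! ### The vector field -/

/-- A Fourier multiplier of order `-2` plus one of order `0`. -/
lemma eLpNorm_weightedFourier_le_of_multiplier {s : ℝ} {n : ℕ} (hsn : s ≤ n + 2) {m₁ m₂ : ℝ → ℂ}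
    {C₁ C₂ : ℝ} (hC₁0 : 0 ≤ C₁) (hC₂0 : 0 ≤ C₂) (hC₁ : ∀ ξ, weight 2 ξ * ‖m₁ ξ‖ ≤ C₁)
    (hC₂ : ∀ ξ, ‖m₂ ξ‖ ≤ C₂)
    {w d z : Lp ℝ 2 (volume : Measure ℝ)}
    (h : fourierL2 w =ᵐ[volume] fun ξ => -(m₁ ξ * fourierL2 d ξ) - m₂ ξ * fourierL2 z ξ) :
    eLpNorm (weightedFourier s w) 2 volume ≤
      ENNReal.ofReal C₁ * eLpNorm (weightedFourier n d) 2 volume +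
        ENNReal.ofReal C₂ * eLpNorm (weightedFourier s z) 2 volume := by
  have h1 : ∀ᵐ ξ, ‖weightedFourier s w ξ‖ ≤
      ‖C₁ * ‖weightedFourier n d ξ‖ + C₂ * ‖weightedFourier s z ξ‖‖ := by
    filter_upwards [h] with ξ hξ
    rw [Real.norm_of_nonneg (by positivity)]
    simp only [weightedFourier, hξ, norm_mul, Complex.norm_real,
      Real.norm_of_nonneg (weight_pos _ _).le]
    have h2 : weight s ξ ≤ weight n ξ * weight 2 ξ := by
      rw [← weight_add]
      exact weight_mono hsn ξ
    have h3 := weight_pos s ξ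
    have h4 := weight_pos n ξ
    have h5 : ‖-(m₁ ξ * fourierL2 d ξ) - m₂ ξ * fourierL2 z ξ‖ ≤
        ‖m₁ ξ‖ * ‖fourierL2 d ξ‖ + ‖m₂ ξ‖ * ‖fourierL2 z ξ‖ := by
      refine (norm_sub_le _ _).trans (le_of_eq ?_)
      rw [norm_neg, norm_mul, norm_mul]
    calc weight s ξ * ‖-(m₁ ξ * fourierL2 d ξ) - m₂ ξ * fourierL2 z ξ‖
        ≤ weight s ξ * (‖m₁ ξ‖ * ‖fourierL2 d ξ‖ + ‖m₂ ξ‖ * ‖fourierL2 z ξ‖) := by gcongr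
      _ = weight s ξ * (‖m₁ ξ‖ * ‖fourierL2 d ξ‖) +
          ‖m₂ ξ‖ * (weight s ξ * ‖fourierL2 z ξ‖) := by ring
      _ ≤ (weight n ξ * weight 2 ξ) * (‖m₁ ξ‖ * ‖fourierL2 d ξ‖) +
          C₂ * (weight s ξ * ‖fourierL2 z ξ‖) := by gcongr; exact hC₂ ξ
      _ = (weight 2 ξ * ‖m₁ ξ‖) * (weight n ξ * ‖fourierL2 d ξ‖) +
          C₂ * (weight s ξ * ‖fourierL2 z ξ‖) := by ring
      _ ≤ C₁ * (weight n ξ * ‖fourierL2 d ξ‖) + C₂ * (weight s ξ * ‖fourierL2 z ξ‖) := by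
          gcongr; exact hC₁ ξ
  refine (eLpNorm_mono_ae h1).trans ?_
  refine (eLpNorm_add_le (((aestronglyMeasurable_weightedFourier _ d).norm).const_mul C₁)
    (((aestronglyMeasurable_weightedFourier _ z).norm).const_mul C₂) (by norm_num)).trans ?_
  refine add_le_add ?_ ?_
  · refine (eLpNorm_const_smul_le (c := C₁) (f := fun ξ => ‖weightedFourier n d ξ‖)).trans ?_
    rw [eLpNorm_norm, Real.enorm_of_nonneg hC₁0]
  · refine (eLpNorm_const_smul_le (c := C₂) (f := fun ξ => ‖weightedFourier s z ξ‖)).trans ?_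
    rw [eLpNorm_norm, Real.enorm_of_nonneg hC₂0]

/-- The equation is an ordinary differential equation in `H^s(ℝ)`, whose vector field is Lipschitz
on bounded sets and is of linear growth on sets which are bounded in `L^∞`. -/
theorem exists_vectorField {α α' α'' : ℝ → ℝ} {μ : SignedMeasure ℝ} (hC1 : CondC1 α α' α'')
    (hC2 : CondC2 α'' μ) {κ : ℝ} (hκ : 0 ≤ κ) {s : ℝ} {n : ℕ} (hs : n + 1 / 2 < s)
    (hsn : s ≤ n + 2) {f : ℝ → ℝ} (hf : ContDiff ℝ (n + 1 : ℕ) f) (hf0 : f 0 = 0) :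
    ∃ F : Hs s → Hs s,
      (∀ u v : Hs s, v = F u ↔ ∀ᵐ x : ℝ,
        v x + (α' ⋆[ContinuousLinearMap.mul ℝ ℝ, volume] fun y => f (u y)) x
          + κ * ∫ᵛ y, u (x - y) ∂•μ = 0) ∧
      (∀ R : ℝ, ∃ K : ℝ≥0, LipschitzOnWith K F (Metric.closedBall 0 R)) ∧
      ∀ M : ℝ, 0 ≤ M → ∃ K : ℝ, 0 ≤ K ∧ ∀ u : Hs s, (∀ᵐ x, |u x| ≤ M) → ‖F u‖ ≤ K * ‖u‖ := by
  obtain ⟨hmem, hlip⟩ := Hs.memLp_comp_and_lipschitz hs hf hf0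
  obtain ⟨C₁, hC₁0, hC₁⟩ := exists_weight_two_mul_fourier_le hC1 hC2
  obtain ⟨C₂, hC₂0, hC₂⟩ := exists_norm_symbol_le μ
  have hC₂' : ∀ ξ, ‖κ * symbol μ ξ‖ ≤ κ * C₂ := fun ξ => by
    rw [norm_mul, Complex.norm_real, Real.norm_of_nonneg hκ]
    exact mul_le_mul_of_nonneg_left (hC₂ ξ) hκ
  have hest : ∀ {w d z : Lp ℝ 2 (volume : Measure ℝ)}, (fourierL2 w =ᵐ[volume] fun ξ =>
      -(𝓕 (fun x => (α' x : ℂ)) ξ * fourierL2 d ξ) - (κ * symbol μ ξ) * fourierL2 z ξ) →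
      eLpNorm (weightedFourier s w) 2 volume ≤
      ENNReal.ofReal C₁ * eLpNorm (weightedFourier n d) 2 volume +
        ENNReal.ofReal (κ * C₂) * eLpNorm (weightedFourier s z) 2 volume := fun h =>
    eLpNorm_weightedFourier_le_of_multiplier hsn hC₁0 (by positivity) hC₁ hC₂' h
  have hest' : ∀ (w z : Hs s) (d : Lp ℝ 2 (volume : Measure ℝ)) (E : ℝ), 0 ≤ E →
      (fourierL2 (Hs.toL2 w) =ᵐ[volume] fun ξ => -(𝓕 (fun x => (α' x : ℂ)) ξ * fourierL2 d ξ) -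
        (κ * symbol μ ξ) * fourierL2 (Hs.toL2 z) ξ) →
      eLpNorm (weightedFourier n d) 2 volume ≤ ENNReal.ofReal E →
      ‖w‖ ≤ C₁ * E + κ * C₂ * ‖z‖ := by
    intro w z d E hE h hd
    have h1 := hest h
    rw [Hs.eLpNorm_weightedFourier, Hs.eLpNorm_weightedFourier] at h1
    have h2 := h1.trans (add_le_add_left (mul_le_mul_right hd _) _)
    rw [← ENNReal.ofReal_mul hC₁0, ← ENNReal.ofReal_mul (by positivity),
      ← ENNReal.ofReal_add (by positivity) (by positivity)] at h2
    exact (ENNReal.ofReal_le_ofReal_iff (by positivity)).1 h2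
  let a : Hs s → Lp ℝ 2 (volume : Measure ℝ) := fun u => (hmem u).toLp _
  have ha : ∀ u, a u =ᵐ[volume] fun x => f (u x) := fun u => (hmem u).coeFn_toLp
  have hF : ∀ u : Hs s, ∃ w : Hs s,
      (w =ᵐ[volume] fun x => -(α' ⋆[ContinuousLinearMap.mul ℝ ℝ, volume] fun y => f (u y)) x
          - κ * ∫ᵛ y, u (x - y) ∂•μ) ∧
      fourierL2 (Hs.toL2 w) =ᵐ[volume] fun ξ => -(𝓕 (fun x => (α' x : ℂ)) ξ * fourierL2 (a u) ξ) -
        (κ * symbol μ ξ) * fourierL2 (Hs.toL2 u) ξ := by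
    intro u
    obtain ⟨A, hA, hA'⟩ := exists_convolution hC1.integrable_deriv (hmem u) (a u) (ha u)
    obtain ⟨B, hB, hB'⟩ := exists_signedMeasure_conv μ (Hs.toL2 u)
    have h1 : fourierL2 ((-1 : ℝ) • A - κ • B) =ᵐ[volume] fun ξ =>
        -(𝓕 (fun x => (α' x : ℂ)) ξ * fourierL2 (a u) ξ) -
        (κ * symbol μ ξ) * fourierL2 (Hs.toL2 u) ξ := by
      rw [fourierL2_sub, fourierL2_smul, fourierL2_smul]
      filter_upwards [Lp.coeFn_sub ((-1 : ℝ) • fourierL2 A) (κ • fourierL2 B),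
        Lp.coeFn_smul (-1 : ℝ) (fourierL2 A), Lp.coeFn_smul κ (fourierL2 B), hA', hB']
        with ξ h1 h2 h3 h4 h5
      rw [h1, Pi.sub_apply, h2, h3, Pi.smul_apply, Pi.smul_apply, h4, h5]
      simp only [Complex.real_smul]
      push_cast
      ring
    have h2 : eLpNorm (weightedFourier n (a u)) 2 volume < ∞ := by
      obtain ⟨L, -, hL⟩ := hlip ‖u‖ (norm_nonneg u)
      refine (hL u 0 le_rfl (by simp) (a u) ?_).trans_lt ENNReal.ofReal_lt_top
      filter_upwards [ha u, Lp.coeFn_zero ℝ 2 (volume : Measure ℝ)] with x h1 h2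
      change (Hs.toL2 (0 : Hs s)) x = _ at h2
      rw [h1, h2, Pi.zero_apply, hf0, sub_zero]
    have h3 : MemLp (weightedFourier s ((-1 : ℝ) • A - κ • B)) 2 volume := by
      refine ⟨aestronglyMeasurable_weightedFourier _ _, (hest h1).trans_lt ?_⟩
      rw [Hs.eLpNorm_weightedFourier]
      exact ENNReal.add_lt_top.2 ⟨ENNReal.mul_lt_top ENNReal.ofReal_lt_top h2,
        ENNReal.mul_lt_top ENNReal.ofReal_lt_top ENNReal.ofReal_lt_top⟩
    refine ⟨⟨_, h3⟩, ?_, h1⟩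
    filter_upwards [Lp.coeFn_sub ((-1 : ℝ) • A) (κ • B),
        Lp.coeFn_smul (-1 : ℝ) A, Lp.coeFn_smul κ B, hA, hB] with x h1 h2 h3 h4 h5
    refine h1.trans ?_
    rw [Pi.sub_apply, h2, h3, Pi.smul_apply, Pi.smul_apply, h4, h5]
    simp
  choose F hFx hFξ using hF
  refine ⟨F, fun u v => ⟨?_, fun h => Subtype.ext (Lp.ext ?_)⟩, fun R => ?_, fun M hM => ?_⟩
  · rintro rfl
    filter_upwards [hFx u] with x hx
    rw [hx]
    ring
  · filter_upwards [hFx u, h] with x h1 h2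
    refine Eq.trans ?_ h1.symm
    change v x = _
    linarith
  · obtain ⟨L, hL0, hL⟩ := hlip (max R 0) (le_max_right _ _)
    refine ⟨Real.toNNReal (C₁ * L + κ * C₂), LipschitzOnWith.of_dist_le_mul fun u hu v hv => ?_⟩
    rw [Real.coe_toNNReal _ (by positivity), dist_eq_norm, dist_eq_norm]
    rw [mem_closedBall_zero_iff] at hu hv
    have h := hest' (F u - F v) (u - v) (a u - a v) (L * ‖u - v‖) (by positivity) ?_
      (hL u v (hu.trans (le_max_left _ _)) (hv.trans (le_max_left _ _)) (a u - a v) ?_)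
    · linarith
    · have h1 : Hs.toL2 (F u - F v) = Hs.toL2 (F u) - Hs.toL2 (F v) := rfl
      have h2 : Hs.toL2 (u - v) = Hs.toL2 u - Hs.toL2 v := rfl
      rw [h1, h2, fourierL2_sub, fourierL2_sub, fourierL2_sub]
      filter_upwards [hFξ u, hFξ v, Lp.coeFn_sub (fourierL2 (Hs.toL2 (F u))) (fourierL2 (Hs.toL2 (F v))),
        Lp.coeFn_sub (fourierL2 (a u)) (fourierL2 (a v)),
        Lp.coeFn_sub (fourierL2 (Hs.toL2 u)) (fourierL2 (Hs.toL2 v))] with ξ h3 h4 h5 h6 h7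
      rw [h5, h6, h7, Pi.sub_apply, Pi.sub_apply, Pi.sub_apply, h3, h4]
      ring
    · filter_upwards [Lp.coeFn_sub (a u) (a v), ha u, ha v] with x h1 h2 h3
      rw [h1, Pi.sub_apply, h2, h3]
  · obtain ⟨L, hL0, hL⟩ := Hs.exists_moser hs hf hf0 hM
    refine ⟨C₁ * L + κ * C₂, by positivity, fun u hu => ?_⟩
    have h := hest' (F u) u (a u) (L * ‖u‖) (by positivity) (hFξ u) (hL u hu (a u) (ha u))
    linarith

/-! ### Ordinary differential equations with locally Lipschitz vector fields -/

lemma continuous_of_lipschitzOnWith_closedBall {E : Type*} [NormedAddCommGroup E] {F : E → E}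
    (hF : ∀ R : ℝ, ∃ K : ℝ≥0, LipschitzOnWith K F (Metric.closedBall 0 R)) : Continuous F := by
  refine continuous_iff_continuousAt.2 fun x => ?_
  obtain ⟨K, hK⟩ := hF (‖x‖ + 1)
  refine hK.continuousOn.continuousAt (Filter.mem_of_superset
    (Metric.ball_mem_nhds x one_pos) fun y hy => ?_)
  rw [mem_closedBall_zero_iff]
  rw [mem_ball_iff_norm] at hy
  have := norm_le_norm_add_norm_sub' y x
  linarith

section ODE

variable {E : Type*} [NormedAddCommGroup E] [NormedSpace ℝ E] {F : E → E}

lemma hasDerivWithinAt_Ici_of_Icc {u : ℝ → E} {u' : E} {T t : ℝ}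
    (h : HasDerivWithinAt u u' (Icc 0 T) t) (ht : t ∈ Ico 0 T) : HasDerivWithinAt u u' (Ici t) t :=
  h.mono_of_mem_nhdsWithin (Filter.mem_of_superset (Icc_mem_nhdsGE ht.2)
    (Icc_subset_Icc_left ht.1))

lemma eqOn_of_hasDerivWithinAt
    (hF : ∀ R : ℝ, ∃ K : ℝ≥0, LipschitzOnWith K F (Metric.closedBall 0 R)) {T : ℝ} {u v : ℝ → E}
    (hu : ∀ t ∈ Icc 0 T, HasDerivWithinAt u (F (u t)) (Icc 0 T) t)
    (hv : ∀ t ∈ Icc 0 T, HasDerivWithinAt v (F (v t)) (Icc 0 T) t) (h0 : u 0 = v 0) :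
    EqOn u v (Icc 0 T) := by
  have huc : ContinuousOn u (Icc 0 T) := fun t ht => (hu t ht).continuousWithinAt
  have hvc : ContinuousOn v (Icc 0 T) := fun t ht => (hv t ht).continuousWithinAt
  obtain ⟨R₁, hR₁⟩ := isCompact_Icc.exists_bound_of_continuousOn huc
  obtain ⟨R₂, hR₂⟩ := isCompact_Icc.exists_bound_of_continuousOn hvc
  obtain ⟨K, hK⟩ := hF (max R₁ R₂)
  exact ODE_solution_unique_of_mem_Icc_right (v := fun _ => F)
    (s := fun _ => Metric.closedBall 0 (max R₁ R₂)) (fun _ _ => hK) huc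
    (fun t ht => hasDerivWithinAt_Ici_of_Icc (hu t (Ico_subset_Icc_self ht)) ht)
    (fun t ht => mem_closedBall_zero_iff.2
      ((hR₁ t (Ico_subset_Icc_self ht)).trans (le_max_left _ _))) hvc
    (fun t ht => hasDerivWithinAt_Ici_of_Icc (hv t (Ico_subset_Icc_self ht)) ht)
    (fun t ht => mem_closedBall_zero_iff.2
      ((hR₂ t (Ico_subset_Icc_self ht)).trans (le_max_right _ _))) h0

lemma exists_local_flow [CompleteSpace E]
    (hF : ∀ R : ℝ, ∃ K : ℝ≥0, LipschitzOnWith K F (Metric.closedBall 0 R)) (φ : E) :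
    ∃ T > 0, ∃ r > 0, ∃ S : E → ℝ → E,
      (∀ ψ ∈ Metric.ball φ r, S ψ 0 = ψ ∧
        ∀ t ∈ Icc 0 T, HasDerivWithinAt (S ψ) (F (S ψ t)) (Icc 0 T) t) ∧
      ∃ L : ℝ≥0, ∀ ψ ∈ Metric.ball φ r, ∀ χ ∈ Metric.ball φ r, ∀ t ∈ Icc 0 T,
        ‖S χ t - S ψ t‖ ≤ L * ‖χ - ψ‖ ∧ ‖F (S χ t) - F (S ψ t)‖ ≤ L * ‖χ - ψ‖ := by
  obtain ⟨K, hK⟩ := hF (‖φ‖ + 1)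
  have hsub : Metric.closedBall φ 1 ⊆ Metric.closedBall 0 (‖φ‖ + 1) := by
    refine Metric.closedBall_subset_closedBall' ?_
    rw [dist_zero_right, add_comm]
  have hb : ∀ x ∈ Metric.closedBall φ 1, ‖F x‖ ≤ ‖F φ‖₊ + K := by
    intro x hx
    have h1 := (hK.mono hsub).dist_le_mul x hx φ (Metric.mem_closedBall_self zero_le_one)
    rw [dist_eq_norm] at h1
    have h2 := norm_le_norm_add_norm_sub' (F x) (F φ)
    have h3 : (K : ℝ) * dist x φ ≤ K * 1 := by gcongr; exact hx
    simp only [coe_nnnorm]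
    linarith
  set N : ℝ≥0 := ‖F φ‖₊ + K with hN
  set T : ℝ := 1 / (2 * (N + 1)) with hT
  have hT0 : 0 < T := by positivity
  have hP : IsPicardLindelof (fun _ => F) (tmin := 0) (tmax := T)
      ⟨0, left_mem_Icc.2 hT0.le⟩ φ 1 (1 / 2) N K := by
    refine IsPicardLindelof.of_time_independent (fun x hx => ?_) ?_ ?_
    · exact_mod_cast hb x (by simpa using hx)
    · simpa using hK.mono hsub
    · simp only [sub_zero, sub_self, max_eq_left hT0.le]
      have : (N : ℝ) * T ≤ 1 / 2 := by
        rw [hT, mul_one_div, div_le_div_iff₀ (by positivity) (by norm_num)]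
        linarith
      push_cast
      linarith
  obtain ⟨S, hS, L, hL⟩ :=
    hP.exists_forall_mem_closedBall_eq_hasDerivWithinAt_lipschitzOnWith
  have hball : Metric.ball φ (1 / 2) ⊆ Metric.closedBall φ ((1 / 2 : ℝ≥0) : ℝ) := by
    refine Metric.ball_subset_closedBall.trans (le_of_eq ?_)
    norm_num
  have hφ : φ ∈ Metric.closedBall φ ((1 / 2 : ℝ≥0) : ℝ) :=
    Metric.mem_closedBall_self (by positivity)
  have hc : ContinuousOn (S φ) (Icc 0 T) := fun t ht => ((hS φ hφ).2 t ht).continuousWithinAt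
  obtain ⟨R, hR⟩ := isCompact_Icc.exists_bound_of_continuousOn hc
  obtain ⟨K', hK'⟩ := hF (R + L)
  have hbd : ∀ ψ ∈ Metric.ball φ (1 / 2), ∀ t ∈ Icc 0 T,
      S ψ t ∈ Metric.closedBall 0 (R + L) := by
    intro ψ hψ t ht
    have h1 := (hL t ht).dist_le_mul ψ (hball hψ) φ hφ
    rw [dist_eq_norm] at h1
    have h2 := norm_le_norm_add_norm_sub' (S ψ t) (S φ t)
    have h3 : (L : ℝ) * dist ψ φ ≤ L * 1 := by
      gcongr
      exact (Metric.mem_ball.1 hψ).le.trans (by norm_num)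
    rw [mem_closedBall_zero_iff]
    linarith [hR t ht]
  refine ⟨T, hT0, 1 / 2, by norm_num, S, fun ψ hψ => hS ψ (hball hψ), L + K' * L,
    fun ψ hψ χ hχ t ht => ?_⟩
  have h1 := (hL t ht).dist_le_mul χ (hball hχ) ψ (hball hψ)
  have h2 := hK'.dist_le_mul _ (hbd χ hχ t ht) _ (hbd ψ hψ t ht)
  simp only [dist_eq_norm] at h1 h2
  have h3 : 0 ≤ (L : ℝ) * ‖χ - ψ‖ := by positivity
  have h4 : 0 ≤ (K' : ℝ) * (L * ‖χ - ψ‖) := by positivity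
  have h5 : (K' : ℝ) * ‖S χ t - S ψ t‖ ≤ K' * (L * ‖χ - ψ‖) := by gcongr
  push_cast
  constructor <;> linarith

lemma norm_le_mul_exp_of_hasDerivWithinAt {T K : ℝ} {u : ℝ → E}
    (hu : ∀ t ∈ Icc 0 T, HasDerivWithinAt u (F (u t)) (Icc 0 T) t)
    (hK : ∀ t ∈ Icc 0 T, ‖F (u t)‖ ≤ K * ‖u t‖) {t : ℝ} (ht : t ∈ Icc 0 T) :
    ‖u t‖ ≤ ‖u 0‖ * Real.exp (K * t) := by
  have h := norm_le_gronwallBound_of_norm_deriv_right_le (δ := ‖u 0‖) (K := K) (ε := 0)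
    (fun t ht => (hu t ht).continuousWithinAt)
    (fun t ht => hasDerivWithinAt_Ici_of_Icc (hu t (Ico_subset_Icc_self ht)) ht) le_rfl
    (fun t ht => by simpa using hK t (Ico_subset_Icc_self ht)) t ht
  rwa [gronwallBound_ε0, sub_zero] at h

end ODE

/-! ### The Cauchy problem -/

variable {α' : ℝ → ℝ} {μ : SignedMeasure ℝ} {κ : ℝ} {f : ℝ → ℝ} {s : ℝ} {F : Hs s → Hs s}

lemma isSolution_iff
    (hF : ∀ u v : Hs s, v = F u ↔ ∀ᵐ x : ℝ,
        v x + (α' ⋆[ContinuousLinearMap.mul ℝ ℝ, volume] fun y => f (u y)) x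
          + κ * ∫ᵛ y, u (x - y) ∂•μ = 0)
    (hFc : Continuous F) {T : ℝ} (hT : 0 < T) {φ : Hs s} {u : ℝ → Hs s} :
    IsSolution α' μ κ f T φ u ↔
      u 0 = φ ∧ ∀ t ∈ Icc 0 T, HasDerivWithinAt u (F (u t)) (Icc 0 T) t := by
  have hud := uniqueDiffOn_Icc hT
  constructor
  · intro h
    refine ⟨h.initial, fun t ht => ?_⟩
    rw [← (hF (u t) (derivWithin u (Icc 0 T) t)).2 (h.equation t ht)]
    exact (h.contDiffOn.differentiableOn one_ne_zero t ht).hasDerivWithinAt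
  · rintro ⟨h0, h⟩
    have hd : ∀ t ∈ Icc 0 T, derivWithin u (Icc 0 T) t = F (u t) := fun t ht =>
      (h t ht).derivWithin (hud t ht)
    have hc : ContinuousOn u (Icc 0 T) := fun t ht => (h t ht).continuousWithinAt
    exact
      { contDiffOn := (contDiffOn_one_iff_derivWithin hud).2
          ⟨fun t ht => (h t ht).differentiableWithinAt, (hFc.comp_continuousOn hc).congr hd⟩
        initial := h0
        equation := fun t ht => (hF (u t) _).1 (hd t ht) }

theorem locallyWellPosedAt [CompleteSpace (Hs s)]
    (hF : ∀ u v : Hs s, v = F u ↔ ∀ᵐ x : ℝ,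
        v x + (α' ⋆[ContinuousLinearMap.mul ℝ ℝ, volume] fun y => f (u y)) x
          + κ * ∫ᵛ y, u (x - y) ∂•μ = 0)
    (hFlip : ∀ R : ℝ, ∃ K : ℝ≥0, LipschitzOnWith K F (Metric.closedBall 0 R)) (φ : Hs s) :
    LocallyWellPosedAt α' μ κ f φ := by
  have hFc := continuous_of_lipschitzOnWith_closedBall hFlip
  obtain ⟨T, hT, r, hr, S, hS, L, hL⟩ := exists_local_flow hFlip φ
  refine ⟨T, hT, r, hr, S, fun ψ hψ => (isSolution_iff hF hFc hT).2 (hS ψ hψ),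
    fun ψ hψ T' hT' v hv => ?_, fun ψ hψ ε hε => ?_⟩
  · obtain ⟨hv0, hv⟩ := (isSolution_iff hF hFc hT'.1).1 hv
    have hsub : Icc 0 T' ⊆ Icc 0 T := Icc_subset_Icc_right hT'.2
    exact eqOn_of_hasDerivWithinAt hFlip hv
      (fun t ht => ((hS ψ hψ).2 t (hsub ht)).mono hsub) (hv0.trans (hS ψ hψ).1.symm)
  · refine ⟨ε / (L + 1), by positivity, fun χ hχ hlt t ht => ?_⟩
    have hud := uniqueDiffOn_Icc hT t ht
    rw [((hS χ hχ).2 t ht).derivWithin hud, ((hS ψ hψ).2 t ht).derivWithin hud]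
    have h1 : L * ‖χ - ψ‖ < ε := by
      rw [lt_div_iff₀ (by positivity)] at hlt
      nlinarith [norm_nonneg (χ - ψ)]
    exact ⟨(hL ψ hψ χ hχ t ht).1.trans_lt h1, (hL ψ hψ χ hχ t ht).2.trans_lt h1⟩

lemma supLinfty_lt_top {n : ℕ} (hs : n + 1 / 2 < s) {T : ℝ} {u : ℝ → Hs s}
    (hu : ContinuousOn u (Icc 0 T)) : supLinfty T u < ∞ := by
  obtain ⟨C, hC0, hC⟩ := Hs.exists_rep hs
  obtain ⟨R, hR⟩ := isCompact_Icc.exists_bound_of_continuousOn hu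
  refine lt_of_le_of_lt (iSup₂_le fun t ht => ?_) (ENNReal.ofReal_lt_top (r := C * R))
  obtain ⟨w, hw, -, hwb⟩ := hC (u t)
  rw [eLpNorm_exponent_top]
  refine eLpNormEssSup_le_of_ae_bound ?_
  filter_upwards [hw] with x hx
  have h := (hwb 0 (Nat.zero_le _)).1 x
  rw [iteratedDeriv_zero] at h
  rw [hx]
  exact h.trans (mul_le_mul_of_nonneg_left (hR t ht) hC0)

lemma ae_abs_le_supLinfty {T : ℝ} {u : ℝ → Hs s} (h : supLinfty T u < ∞) {t : ℝ}
    (ht : t ∈ Icc 0 T) : ∀ᵐ x, |u t x| ≤ (supLinfty T u).toNNReal := by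
  filter_upwards [enorm_ae_le_eLpNormEssSup (u t) volume] with x hx
  have h1 : eLpNormEssSup (u t) volume ≤ supLinfty T u := by
    rw [← eLpNorm_exponent_top]
    exact le_iSup₂ (f := fun t (_ : t ∈ Icc 0 T) => eLpNorm (u t) ∞ volume) t ht
  have h2 := hx.trans h1
  rw [← ENNReal.coe_toNNReal h.ne, enorm_eq_nnnorm, ENNReal.coe_le_coe] at h2
  exact_mod_cast h2

/-- A family of bounds, one for each integer, gives a monotone bound. -/
lemma exists_monotone_bound {P : ℝ≥0 → ℝ → Prop}
    (hP : ∀ M M' : ℝ≥0, ∀ K K' : ℝ, M ≤ M' → K ≤ K' → P M' K → P M K')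
    (h : ∀ M : ℝ≥0, ∃ K : ℝ, 0 ≤ K ∧ P M K) :
    ∃ C : ℝ≥0 → ℝ, Monotone C ∧ (∀ M, 0 < C M) ∧ ∀ M, P M (C M) := by
  choose K hK0 hK using h
  refine ⟨fun M => ∑ k ∈ Finset.range (⌈M⌉₊ + 1), (K k + 1), fun M M' hM => ?_, fun M => ?_,
    fun M => ?_⟩
  · refine Finset.sum_le_sum_of_subset_of_nonneg ?_ fun k _ _ => add_nonneg (hK0 _) zero_le_one
    exact Finset.range_mono (Nat.add_le_add_right (Nat.ceil_mono hM) 1)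
  · exact Finset.sum_pos (fun k _ => add_pos_of_nonneg_of_pos (hK0 _) one_pos) (by simp)
  · refine hP M ⌈M⌉₊ (K (⌈M⌉₊ : ℝ≥0)) _ (Nat.le_ceil M) ?_ (hK _)
    have := Finset.single_le_sum (f := fun k : ℕ => K k + 1)
      (fun k _ => add_nonneg (hK0 _) zero_le_one) (Finset.self_mem_range_succ ⌈M⌉₊)
    linarith

end

end NonlocalKdV

theorem theorem2p1 (α α' α'' : ℝ → ℝ) (μ : MeasureTheory.SignedMeasure ℝ)
    (hC1 : NonlocalKdV.CondC1 α α' α'') (hC2 : NonlocalKdV.CondC2 α'' μ)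
    (κ : ℝ) (hκ : 0 < κ) (s : ℝ) (hs : 1 / 2 < s)
    (f : ℝ → ℝ) (hf : ContDiff ℝ ((⌊s⌋₊ + 1 : ℕ) : WithTop ℕ∞) f) (hf0 : f 0 = 0) :
    (∀ φ : NonlocalKdV.Hs s, NonlocalKdV.LocallyWellPosedAt α' μ κ f φ) ∧
    ∃ C : ℝ≥0 → ℝ, Monotone C ∧ (∀ M, 0 < C M) ∧
      ∀ (φ : NonlocalKdV.Hs s) (T : ℝ) (u : ℝ → NonlocalKdV.Hs s), 0 < T →
        NonlocalKdV.IsSolution α' μ κ f T φ u →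
        NonlocalKdV.supLinfty T u < ∞ ∧
        ∀ t ∈ Set.Icc 0 T,
          ‖u t‖ ≤ ‖φ‖ * Real.exp (C (NonlocalKdV.supLinfty T u).toNNReal * t) := by
  have hn : ∃ n : ℕ, (n : ℝ) + 1 / 2 < s ∧ s ≤ n + 2 ∧ n ≤ ⌊s⌋₊ := by
    have h1 := Nat.lt_floor_add_one s
    have h2 := Nat.floor_le (a := s) (by linarith)
    rcases h : ⌊s⌋₊ with _ | m
    · rw [h] at h1
      push_cast at h1
      exact ⟨0, by push_cast; linarith, by push_cast; linarith, le_rfl⟩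
    · rw [h] at h1 h2
      push_cast at h1 h2
      exact ⟨m, by linarith, by linarith, Nat.le_succ m⟩
  obtain ⟨n, hs1, hs2, hns⟩ := hn
  have hfn : ContDiff ℝ (n + 1 : ℕ) f := hf.of_le (by exact_mod_cast Nat.succ_le_succ hns)
  obtain ⟨F, hF, hFlip, hFM⟩ :=
    NonlocalKdV.exists_vectorField hC1 hC2 hκ.le hs1 hs2 hfn hf0
  have hFc := NonlocalKdV.continuous_of_lipschitzOnWith_closedBall hFlip
  have : CompleteSpace (NonlocalKdV.Hs s) := NonlocalKdV.Hs.completeSpace (by linarith)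
  refine ⟨NonlocalKdV.locallyWellPosedAt hF hFlip, ?_⟩
  obtain ⟨C, hCmono, hCpos, hC⟩ := NonlocalKdV.exists_monotone_bound
    (P := fun M K => ∀ u : NonlocalKdV.Hs s, (∀ᵐ x, |u x| ≤ M) → ‖F u‖ ≤ K * ‖u‖)
    (fun M M' K K' hM hK h u hu => (h u (hu.mono fun x hx => hx.trans hM)).trans
      (mul_le_mul_of_nonneg_right hK (norm_nonneg u))) (fun M => hFM M M.2)
  refine ⟨C, hCmono, hCpos, fun φ T u hT hu => ?_⟩
  obtain ⟨rfl, hu'⟩ := (NonlocalKdV.isSolution_iff hF hFc hT).1 hu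
  have hsup : NonlocalKdV.supLinfty T u < ∞ :=
    NonlocalKdV.supLinfty_lt_top hs1 fun t ht => (hu' t ht).continuousWithinAt
  exact ⟨hsup, fun t ht => NonlocalKdV.norm_le_mul_exp_of_hasDerivWithinAt hu'
    (fun t ht => hC _ (u t) (NonlocalKdV.ae_abs_le_supLinfty hsup ht)) ht⟩
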